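/- Let $X$ be a locally compact Hausdorff space and let $(A,X,\mu_A)$ be a $C_0(X)$-algebra, i.e. $A$ is a C*-algebra and $\mu_A:C_0(X)\to ZM(A)$ is a nondegenerate $*$-homomorphism into the centre of the multiplier algebra of $A$. For $x\in X$ put $J_x=\mu_A(\{f: f(x)=0\})A$, $A_x=A/J_x$, $a(x)=a+J_x$, and $X_A=\{x\in X: A_x\neq 0\}$. For every continuous map $\iota:X_A\to K$ into a compact Hausdorff space, $A$ is a $C(K)$-algebra with structure map $\mu_A^K$ determined by $(\mu_A^K(f)a)(x)=f(\iota(x))a(x)$ $(x\in X_A)$. Let $\mu_{M(A)}:C(\beta X)\to ZM(A)$ be the unital $*$-homomorphism extending $\mu_A$, put $H_x=\mu_{M(A)}(\{f\in C(\beta X): f(x)=0\})M(A)$ and $A^\beta=\bigcap_{x\in X_A}(A+H_x)$, a closed ideal of $M(A)$ containing $A$. Let $\nu_A=\mu_A^{\beta X_A}:C(\beta X_A)\to ZM(A)$; multiplication by $\nu_A(f)$ makes $A^\beta$ a $C(\beta X_A)$-algebra $(A^\beta,\beta X_A,\mu_{A^\beta})$. For a compactification $K$ of $X_A$ let $\psi_K:C(K)\to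 C(\beta X_A)$ be composition with the canonical map $\beta X_A\to K$, and put $\mu^K_{A^\beta}=\mu_{A^\beta}\circ\psi_K$, so that $(A^\beta,K,\mu^K_{A^\beta})$ is a $C(K)$-algebra. A compactification of $(A,X,\mu_A)$ is a $C(K)$-algebra $(B,K,\mu_B)$, where $K$ is a compactification of $X_A$, with an injective $C(K)$-linear $*$-homomorphism $A\to B$ (with respect to $\mu^K_A$ and $\mu_B$) whose image is an essential ideal of $B$ and which induces isomorphisms $A_x\to B_x$ for all $x\in X_A$. A morphism $(A,X,\mu_A)\to(B,Y,\mu_B)$ is a pair of $*$-homomorphisms $\Psi:A\to B$, $\psi:C_0(X)\to C_0(Y)$ with $\Psi(\mu_A(f)a)=\mu_B(\psi(f))\Psi(a)$; with $\psi^*$ the map dual to $\psi$, it induces $\Psi_y:A_{\psi^*(y)}\to B_y$, $a(\psi^*(y))\mapsto\Psi(a)(y)$, for the points $y$ with $\psi(C_0(X))(y)\neq0$, in particular for $y\in Y_B$. The morphism is injective if $\Psi$ and all $\Psi_y$, $y\in Y_B$, are injective. A $C_0(X)$-algebra is continuous if $x\mapsto\|a(x)\|$ is continuous on $X$ for every $a$.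 Theorem. Let $(B,K,\mu_B)$ be a compactification of $(A,X,\mu_A)$. (i) There is an injective $*$-homomorphism $\Phi:B\to A^\beta$ extending the identity on $A$. (ii) $\Phi$ is $C(K)$-linear with respect to $\mu_B$ and $\mu^K_{A^\beta}$, and $(\Phi,\mathrm{id}_{C(K)})$ is an injective morphism $(B,K,\mu_B)\to(A^\beta,K,\mu^K_{A^\beta})$. (iii) $(\Phi,\psi_K)$ is a morphism $(B,K,\mu_B)\to(A^\beta,\beta X_A,\mu_{A^\beta})$. If in addition $X_A=X$ and $(B,K,\mu_B)$ is a continuous $C(K)$-algebra, this morphism is injective. -/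

import Mathlib

open scoped ZeroAtInfty MultiplierAlgebra BoundedContinuousFunction

noncomputable section

namespace DoubleCentralizer

variable {A : Type*} [NonUnitalCStarAlgebra A]

theorem ext_fst {m n : 𝓜(ℂ, A)} (h : ∀ a, m.fst a = n.fst a) : m = n := by
  have h1 : (m - n).fst = 0 := by
    ext a; simp [h a]
  have h2 : ‖m - n‖ = 0 := by rw [← norm_fst, h1, norm_zero]
  exact sub_eq_zero.mp (norm_eq_zero.mp h2)

theorem mul_coe_eq (m : 𝓜(ℂ, A)) (a : A) : m * (a : 𝓜(ℂ, A)) = ((m.fst a : A) : 𝓜(ℂ, A)) := by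
  refine ext_fst fun b => ?_
  have h : ∀ c : A, c * (m.fst (a * b) - m.fst a * b) = 0 := fun c => by
    rw [mul_sub, ← m.central, ← mul_assoc, ← mul_assoc, m.central, sub_self]
  have := h (star (m.fst (a * b) - m.fst a * b))
  rw [CStarRing.star_mul_self_eq_zero_iff] at this
  simpa [mul_fst, sub_eq_zero] using this

theorem coe_mul_eq (m : 𝓜(ℂ, A)) (a : A) : (a : 𝓜(ℂ, A)) * m = ((m.snd a : A) : 𝓜(ℂ, A)) := by
  refine ext_fst fun b => ?_
  simp [mul_fst, m.central]

theorem norm_coe' (a : A) : ‖(a : 𝓜(ℂ, A))‖ = ‖a‖ := by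
  rw [← norm_fst, coe_fst]
  exact ContinuousLinearMap.opNorm_mul_apply ℂ A a

theorem coe_inj' {a b : A} (h : (a : 𝓜(ℂ, A)) = (b : 𝓜(ℂ, A))) : a = b := by
  have h1 : ((a - b : A) : 𝓜(ℂ, A)) = 0 := by
    have := map_sub (coeHom (𝕜 := ℂ) (A := A)) a b
    simp only [coeHom_apply] at this
    rw [this, h, sub_self]
  have := norm_coe' (a - b)
  rw [h1, norm_zero] at this
  exact sub_eq_zero.mp (norm_eq_zero.mp this.symm)

theorem fst_eq_snd_of_central {z : 𝓜(ℂ, A)} (hz : ∀ m, Commute z m) (a : A) :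
    z.snd a = z.fst a :=
  coe_inj' (by rw [← mul_coe_eq, ← coe_mul_eq]; exact (hz _).symm)

end DoubleCentralizer

/-- A `C₀(X)`-algebra structure on the C*-algebra `A`: a nondegenerate *-homomorphism from
`C₀(X)` into the centre of the multiplier algebra of `A`. As usual, the product of a set of
multipliers and a set of elements of `A` denotes the closed linear span of the products. -/
structure C0Algebra (X A : Type*) [TopologicalSpace X] [NonUnitalCStarAlgebra A] where
  /-- the structure map -/
  μ : C₀(X, ℂ) →⋆ₙₐ[ℂ] 𝓜(ℂ, A)
  central : ∀ f (m : 𝓜(ℂ, A)), Commute (μ f) m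
  nondegenerate :
    (Submodule.span ℂ {y : A | ∃ f a, (μ f).fst a = y}).topologicalClosure = ⊤

namespace C0Algebra

open DoubleCentralizer

variable {X A : Type*} [TopologicalSpace X] [NonUnitalCStarAlgebra A]

/-- The ideal `J_x = μ({f : f x = 0}) A` of `A`. -/
def fibreIdeal (𝒜 : C0Algebra X A) (x : X) : Submodule ℂ A :=
  (Submodule.span ℂ {y : A | ∃ f a, f x = 0 ∧ (𝒜.μ f).fst a = y}).topologicalClosure

/-- The fibre `A_x = A / J_x`, with the quotient norm. -/
abbrev Fibre (𝒜 : C0Algebra X A) (x : X) : Type _ := A ⧸ 𝒜.fibreIdeal x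

/-- The value `a(x)` of `a` in the fibre `A_x`. -/
def eval (𝒜 : C0Algebra X A) (x : X) (a : A) : 𝒜.Fibre x := (𝒜.fibreIdeal x).mkQ a

/-- The set `X_A` of points whose fibre is nonzero. -/
def support (𝒜 : C0Algebra X A) : Set X := {x | 𝒜.fibreIdeal x ≠ ⊤}

/-- `A` is a continuous `C₀(X)`-algebra: all the norm functions `x ↦ ‖a(x)‖` are continuous. -/
def IsContinuous (𝒜 : C0Algebra X A) : Prop := ∀ a : A, Continuous fun x => ‖𝒜.eval x a‖

/-! ### Multiplication of `A` by bounded continuous functions on `X_A` -/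

section Aux

variable (𝒜 : C0Algebra X A)

theorem isClosed_fibreIdeal (x : X) : IsClosed (𝒜.fibreIdeal x : Set A) :=
  Submodule.isClosed_topologicalClosure _

theorem act_act (f g : C₀(X, ℂ)) (a : A) : (𝒜.μ f).fst ((𝒜.μ g).fst a) = (𝒜.μ (f * g)).fst a := by
  rw [map_mul, mul_fst]; rfl

theorem norm_act_le (f : C₀(X, ℂ)) (a : A) : ‖(𝒜.μ f).fst a‖ ≤ ‖f‖ * ‖a‖ := by
  refine (ContinuousLinearMap.le_opNorm _ _).trans ?_
  rw [norm_fst]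
  gcongr
  exact NonUnitalStarAlgHom.norm_apply_le 𝒜.μ f

theorem fst_mem_fibreIdeal (m : 𝓜(ℂ, A)) {x : X} {a : A} (ha : a ∈ 𝒜.fibreIdeal x) :
    m.fst a ∈ 𝒜.fibreIdeal x := by
  have : 𝒜.fibreIdeal x ≤ (𝒜.fibreIdeal x).comap (m.fst : A →ₗ[ℂ] A) := by
    refine Submodule.topologicalClosure_minimal _ ?_
      ((𝒜.isClosed_fibreIdeal x).preimage m.fst.continuous)
    refine Submodule.span_le.mpr ?_
    rintro _ ⟨f, a, hf, rfl⟩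
    refine Submodule.le_topologicalClosure _ (Submodule.subset_span ⟨f, m.fst a, hf, ?_⟩)
    apply coe_inj'
    simp only [← mul_coe_eq, ContinuousLinearMap.coe_coe]
    rw [← mul_assoc, (𝒜.central f m).eq, mul_assoc]
  exact this ha

theorem snd_mem_fibreIdeal (m : 𝓜(ℂ, A)) {x : X} {a : A} (ha : a ∈ 𝒜.fibreIdeal x) :
    m.snd a ∈ 𝒜.fibreIdeal x := by
  have : 𝒜.fibreIdeal x ≤ (𝒜.fibreIdeal x).comap (m.snd : A →ₗ[ℂ] A) := by
    refine Submodule.topologicalClosure_minimal _ ?_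
      ((𝒜.isClosed_fibreIdeal x).preimage m.snd.continuous)
    refine Submodule.span_le.mpr ?_
    rintro _ ⟨f, a, hf, rfl⟩
    refine Submodule.le_topologicalClosure _ (Submodule.subset_span ⟨f, m.snd a, hf, ?_⟩)
    apply coe_inj'
    simp only [ContinuousLinearMap.coe_coe, ← coe_mul_eq]
    rw [← mul_coe_eq, ← mul_coe_eq, ← coe_mul_eq, mul_assoc]
  exact this ha

theorem star_mem_fibreIdeal {x : X} {a : A} (ha : a ∈ 𝒜.fibreIdeal x) :
    star a ∈ 𝒜.fibreIdeal x := by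
  let T : A →ₛₗ[starRingEnd ℂ] A :=
    { toFun := star, map_add' := star_add, map_smul' := star_smul }
  have : 𝒜.fibreIdeal x ≤ (𝒜.fibreIdeal x).comap T := by
    refine Submodule.topologicalClosure_minimal _ ?_
      ((𝒜.isClosed_fibreIdeal x).preimage continuous_star)
    refine Submodule.span_le.mpr ?_
    rintro _ ⟨f, a, hf, rfl⟩
    refine Submodule.le_topologicalClosure _
      (Submodule.subset_span ⟨star f, star a, by simp [hf], ?_⟩)
    have h := map_star 𝒜.μ f
    rw [h, star_fst, star_star, fst_eq_snd_of_central (𝒜.central f)]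
    rfl
  exact this ha

theorem act_sub_mem (f : C₀(X, ℂ)) (x : X) (a : A) :
    (𝒜.μ f).fst a - f x • a ∈ 𝒜.fibreIdeal x := by
  let T : A →L[ℂ] A := (𝒜.μ f).fst - f x • ContinuousLinearMap.id ℂ A
  have : (⊤ : Submodule ℂ A) ≤ (𝒜.fibreIdeal x).comap (T : A →ₗ[ℂ] A) := by
    rw [← 𝒜.nondegenerate]
    refine Submodule.topologicalClosure_minimal _ ?_
      ((𝒜.isClosed_fibreIdeal x).preimage T.continuous)
    refine Submodule.span_le.mpr ?_
    rintro _ ⟨g, a, rfl⟩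
    refine Submodule.le_topologicalClosure _
      (Submodule.subset_span ⟨f * g - f x • g, a, by simp, ?_⟩)
    simp [T, map_sub, map_smul, mul_fst]
  exact this (Submodule.mem_top (x := a))

theorem norm_eval_le_of_sub_mem {x : X} {a b : A} (h : a - b ∈ 𝒜.fibreIdeal x) :
    ‖𝒜.eval x a‖ ≤ ‖b‖ := by
  have : 𝒜.eval x a = 𝒜.eval x b := (Submodule.Quotient.eq _).mpr h
  rw [this]
  exact Submodule.Quotient.norm_mk_le _ _

theorem exists_mem_of_norm_eval_lt {x : X} {a : A} {c : ℝ} (h : ‖𝒜.eval x a‖ < c) :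
    ∃ j ∈ 𝒜.fibreIdeal x, ‖a - j‖ < c := by
  obtain ⟨m, hm, hmc⟩ := QuotientAddGroup.norm_lt_iff.mp h
  refine ⟨a - m, ?_, by simpa using hmc⟩
  rw [← Submodule.Quotient.eq]
  exact hm.symm


theorem norm_le_of_forall {f : C₀(X, ℂ)} {c : ℝ} (hc : 0 ≤ c) (h : ∀ x, ‖f x‖ ≤ c) : ‖f‖ ≤ c :=
  (BoundedContinuousFunction.norm_le (f := f.toBCF) hc).mpr h

theorem norm_act_le_of_forall {f : C₀(X, ℂ)} {c : ℝ} (hc : 0 ≤ c) (h : ∀ x, ‖f x‖ ≤ c) (a : A) :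
    ‖(𝒜.μ f).fst a‖ ≤ c * ‖a‖ :=
  (𝒜.norm_act_le f a).trans (by gcongr; exact norm_le_of_forall hc h)

theorem exists_isCompact_act (a : A) {ε : ℝ} (hε : 0 < ε) :
    ∃ C : Set X, IsCompact C ∧ ∀ g : C₀(X, ℂ), (∀ x, ‖g x‖ ≤ 1) → (∀ x ∈ C, g x = 1) →
      ‖a - (𝒜.μ g).fst a‖ ≤ ε := by
  have key : ∀ s ∈ Submodule.span ℂ {y : A | ∃ f a, (𝒜.μ f).fst a = y}, ∀ ε : ℝ, 0 < ε →
      ∃ C : Set X, IsCompact C ∧ ∀ g : C₀(X, ℂ), (∀ x, ‖g x‖ ≤ 1) → (∀ x ∈ C, g x = 1) →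
      ‖s - (𝒜.μ g).fst s‖ ≤ ε := by
    intro s hs
    induction hs using Submodule.span_induction with
    | mem y hy =>
      obtain ⟨f, a, rfl⟩ := hy
      intro ε hε
      set δ := ε / (2 * (‖a‖ + 1)) with hδ
      have hpos : 0 < ‖a‖ + 1 := by positivity
      have hδ0 : 0 < δ := by positivity
      have h1 := (zero_at_infty f).eventually (Metric.ball_mem_nhds (0 : ℂ) hδ0)
      obtain ⟨C, hC, hC'⟩ := Filter.mem_cocompact.mp h1
      refine ⟨C, hC, fun g hg hg1 => ?_⟩
      have h2 : (𝒜.μ f).fst a - (𝒜.μ g).fst ((𝒜.μ f).fst a) = (𝒜.μ (f - g * f)).fst a := by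
        rw [act_act, map_sub, sub_fst]; rfl
      rw [h2]
      refine (𝒜.norm_act_le_of_forall (c := 2 * δ) (by positivity) (fun x => ?_) a).trans ?_
      · by_cases hx : x ∈ C
        · simp [hg1 x hx, hδ0.le]
        · have h3 : ‖f x‖ < δ := by simpa using hC' hx
          have h4 : (f - g * f) x = (1 - g x) * f x := by simp; ring
          rw [h4, norm_mul]
          have h5 : ‖1 - g x‖ ≤ 2 := by
            refine (norm_sub_le _ _).trans ?_
            rw [norm_one]; linarith [hg x]
          gcongr
      · rw [hδ]
        have : 2 * (ε / (2 * (‖a‖ + 1))) * ‖a‖ = ε * (‖a‖ / (‖a‖ + 1)) := by field_simp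
        rw [this]
        have : ‖a‖ / (‖a‖ + 1) ≤ 1 := (div_le_one hpos).mpr (by linarith)
        nlinarith
    | zero => exact fun ε hε => ⟨∅, isCompact_empty, fun g _ _ => by simpa using hε.le⟩
    | add y z _ _ hy hz =>
      intro ε hε
      obtain ⟨C, hC, h⟩ := hy (ε / 2) (by positivity)
      obtain ⟨D, hD, h'⟩ := hz (ε / 2) (by positivity)
      refine ⟨C ∪ D, hC.union hD, fun g hg hg1 => ?_⟩
      have e1 := h g hg fun x hx => hg1 x (.inl hx)
      have e2 := h' g hg fun x hx => hg1 x (.inr hx)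
      have : y + z - (𝒜.μ g).fst (y + z) =
        (y - (𝒜.μ g).fst y) + (z - (𝒜.μ g).fst z) := by rw [map_add]; abel
      rw [this]
      exact (norm_add_le _ _).trans (by linarith)
    | smul c y _ hy =>
      intro ε hε
      obtain ⟨C, hC, h⟩ := hy (ε / (‖c‖ + 1)) (by positivity)
      refine ⟨C, hC, fun g hg hg1 => ?_⟩
      rw [map_smul, ← smul_sub, norm_smul]
      have h1 := h g hg hg1
      have hpos : 0 < ‖c‖ + 1 := by positivity
      rw [le_div_iff₀ hpos] at h1
      nlinarith [norm_nonneg (y - (𝒜.μ g).fst y)]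
  have ha : a ∈ (Submodule.span ℂ {y : A | ∃ f a, (𝒜.μ f).fst a = y}).topologicalClosure := by
    rw [𝒜.nondegenerate]; trivial
  obtain ⟨s, hs, has⟩ := Metric.mem_closure_iff.mp ha (ε / 4) (by positivity)
  obtain ⟨C, hC, h⟩ := key s hs (ε / 2) (by positivity)
  refine ⟨C, hC, fun g hg hg1 => ?_⟩
  have h1 := h g hg hg1
  have h2 := 𝒜.norm_act_le_of_forall zero_le_one hg (a - s)
  rw [dist_eq_norm] at has
  have : a - (𝒜.μ g).fst a = (a - s) + (s - (𝒜.μ g).fst s) - (𝒜.μ g).fst (a - s) := by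
    rw [map_sub]; abel
  rw [this]
  refine (norm_sub_le _ _).trans ?_
  linarith [norm_add_le (a - s) (s - (𝒜.μ g).fst s)]

theorem exists_isOpen_act {x : X} {a : A} (ha : a ∈ 𝒜.fibreIdeal x) {ε : ℝ} (hε : 0 < ε) :
    ∃ U : Set X, IsOpen U ∧ x ∈ U ∧ ∀ g : C₀(X, ℂ), (∀ x, ‖g x‖ ≤ 1) → (∀ x ∉ U, g x = 0) →
      ‖(𝒜.μ g).fst a‖ ≤ ε := by
  have key : ∀ s ∈ Submodule.span ℂ {y : A | ∃ f a, f x = 0 ∧ (𝒜.μ f).fst a = y}, ∀ ε : ℝ, 0 < ε →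
      ∃ U : Set X, IsOpen U ∧ x ∈ U ∧ ∀ g : C₀(X, ℂ), (∀ x, ‖g x‖ ≤ 1) → (∀ x ∉ U, g x = 0) →
      ‖(𝒜.μ g).fst s‖ ≤ ε := by
    intro s hs
    induction hs using Submodule.span_induction with
    | mem y hy =>
      obtain ⟨f, a, hf, rfl⟩ := hy
      intro ε hε
      have hpos : 0 < ‖a‖ + 1 := by positivity
      set δ := ε / (‖a‖ + 1) with hδ
      have hδ0 : 0 < δ := by positivity
      refine ⟨{y | ‖f y‖ < δ}, isOpen_lt (by fun_prop) continuous_const, by simpa [hf] using hδ0,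
        fun g hg hg1 => ?_⟩
      rw [act_act]
      refine (𝒜.norm_act_le_of_forall (c := δ) (by positivity) (fun x => ?_) a).trans ?_
      · by_cases hx : ‖f x‖ < δ
        · rw [ZeroAtInftyContinuousMap.mul_apply, norm_mul]
          have := hg x
          nlinarith [norm_nonneg (f x), norm_nonneg (g x)]
        · simp [hg1 x hx, hδ0.le]
      · rw [hδ, div_mul_eq_mul_div, div_le_iff₀ hpos]
        nlinarith [norm_nonneg a]
    | zero => exact fun ε hε => ⟨Set.univ, isOpen_univ, trivial, fun g _ _ => by simpa using hε.le⟩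
    | add y z _ _ hy hz =>
      intro ε hε
      obtain ⟨U, hU, hxU, h⟩ := hy (ε / 2) (by positivity)
      obtain ⟨V, hV, hxV, h'⟩ := hz (ε / 2) (by positivity)
      refine ⟨U ∩ V, hU.inter hV, ⟨hxU, hxV⟩, fun g hg hg1 => ?_⟩
      have e1 := h g hg fun x hx => hg1 x fun hx' => hx hx'.1
      have e2 := h' g hg fun x hx => hg1 x fun hx' => hx hx'.2
      rw [map_add]
      exact (norm_add_le _ _).trans (by linarith)
    | smul c y _ hy =>
      intro ε hε
      obtain ⟨U, hU, hxU, h⟩ := hy (ε / (‖c‖ + 1)) (by positivity)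
      refine ⟨U, hU, hxU, fun g hg hg1 => ?_⟩
      rw [map_smul, norm_smul]
      have h1 := h g hg hg1
      have hpos : 0 < ‖c‖ + 1 := by positivity
      rw [le_div_iff₀ hpos] at h1
      nlinarith [norm_nonneg ((𝒜.μ g).fst y)]
  obtain ⟨s, hs, has⟩ := Metric.mem_closure_iff.mp ha (ε / 2) (by positivity)
  obtain ⟨U, hU, hxU, h⟩ := key s hs (ε / 2) (by positivity)
  refine ⟨U, hU, hxU, fun g hg hg1 => ?_⟩
  have h1 := h g hg hg1
  have h2 := 𝒜.norm_act_le_of_forall zero_le_one hg (a - s)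
  rw [dist_eq_norm] at has
  have : (𝒜.μ g).fst a = (𝒜.μ g).fst s + (𝒜.μ g).fst (a - s) := by
    rw [map_sub]; abel
  rw [this]
  exact (norm_add_le _ _).trans (by linarith)

theorem exists_isOpen_of_norm_eval_lt {x : X} {a : A} {c : ℝ} (h : ‖𝒜.eval x a‖ < c) :
    ∃ U : Set X, IsOpen U ∧ x ∈ U ∧ ∀ g : C₀(X, ℂ), (∀ x, ‖g x‖ ≤ 1) → (∀ x ∉ U, g x = 0) →
      ‖(𝒜.μ g).fst a‖ ≤ c := by
  obtain ⟨j, hj, hc⟩ := 𝒜.exists_mem_of_norm_eval_lt h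
  obtain ⟨U, hU, hxU, hg⟩ := 𝒜.exists_isOpen_act hj (sub_pos.mpr hc)
  refine ⟨U, hU, hxU, fun g hg1 hg0 => ?_⟩
  have h1 := hg g hg1 hg0
  have h2 := 𝒜.norm_act_le_of_forall zero_le_one hg1 (a - j)
  have : (𝒜.μ g).fst a = (𝒜.μ g).fst j + (𝒜.μ g).fst (a - j) := by
    rw [map_sub]; abel
  rw [this]
  exact (norm_add_le _ _).trans (by linarith)

/-- A compactly supported real function as an element of `C₀(X)`. -/
def ofReal (h : C(X, ℝ)) (hc : HasCompactSupport h) : C₀(X, ℂ) where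
  toFun x := (h x : ℂ)
  continuous_toFun := by fun_prop
  zero_at_infty' := (hc.comp_left (g := fun r : ℝ => (r : ℂ)) (by simp)).is_zero_at_infty

theorem norm_ofReal_le {h : C(X, ℝ)} (hc : HasCompactSupport h)
    (h1 : ∀ x, h x ∈ Set.Icc (0 : ℝ) 1) (x : X) : ‖ofReal h hc x‖ ≤ 1 := by
  change ‖(h x : ℂ)‖ ≤ 1
  rw [Complex.norm_real, Real.norm_eq_abs, abs_le]
  exact ⟨by linarith [(h1 x).1], (h1 x).2⟩

theorem norm_le_of_partition {M ι : Type*} [CStarAlgebra M] [Fintype ι] {b : M}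
    (hb : IsSelfAdjoint b) (z k : ι → M) (hk : ∀ i, Commute (k i) b) (hz : ∑ i, z i = 1)
    (hzk : ∀ i, z i * k i = z i) {c : ℝ} (hc : 0 < c) (hkb : ∀ i, ‖k i * b‖ ≤ c) : ‖b‖ ≤ c := by
  have hpow : ∀ i n, z i * b ^ n = z i * (k i * b) ^ n := by
    intro i n
    have h1 : ∀ n, z i * k i ^ n = z i := by
      intro n
      induction n with
      | zero => simp
      | succ n ih => rw [pow_succ, ← mul_assoc, ih, hzk]
    rw [(hk i).mul_pow, ← mul_assoc, h1]
  by_contra! hlt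
  set S : ℝ := ∑ i, ‖z i‖ with hS
  have hbound : ∀ n : ℕ, ‖b‖ ^ 2 ^ n ≤ S * c ^ 2 ^ n := by
    intro n
    rw [← hb.norm_pow_two_pow]
    have : b ^ 2 ^ n = ∑ i, z i * (k i * b) ^ 2 ^ n := by
      rw [← Finset.sum_congr rfl fun i _ => hpow i _, ← Finset.sum_mul, hz, one_mul]
    rw [this, hS, Finset.sum_mul]
    refine (norm_sum_le _ _).trans (Finset.sum_le_sum fun i _ => ?_)
    refine (norm_mul_le _ _).trans ?_
    gcongr
    refine (norm_pow_le' _ (by positivity)).trans ?_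
    gcongr
    exact hkb i
  have hq : 1 < ‖b‖ / c := (one_lt_div hc).mpr hlt
  obtain ⟨m, hm⟩ := pow_unbounded_of_one_lt S hq
  have h1 := hbound m
  have h2 : (‖b‖ / c) ^ m ≤ (‖b‖ / c) ^ 2 ^ m := pow_le_pow_right₀ hq.le m.lt_two_pow_self.le
  rw [div_pow _ _ (2 ^ m), le_div_iff₀ (by positivity)] at h2
  have : 0 < c ^ 2 ^ m := by positivity
  nlinarith

theorem eval_eq_zero_iff {x : X} {a : A} : 𝒜.eval x a = 0 ↔ a ∈ 𝒜.fibreIdeal x :=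
  Submodule.Quotient.mk_eq_zero _

theorem mem_of_norm_eval_le_zero {x : X} {a : A} (h : ‖𝒜.eval x a‖ ≤ 0) :
    a ∈ 𝒜.fibreIdeal x := by
  rw [← SetLike.mem_coe, ← (𝒜.isClosed_fibreIdeal x).closure_eq, Metric.mem_closure_iff]
  intro ε hε
  obtain ⟨j, hj, h1⟩ := 𝒜.exists_mem_of_norm_eval_lt (h.trans_lt hε)
  exact ⟨j, hj, by rwa [dist_eq_norm]⟩

theorem fibreIdeal_eq_top {x : X} (hx : x ∉ 𝒜.support) : 𝒜.fibreIdeal x = ⊤ := by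
  simpa [support] using hx

theorem norm_eval_le_norm (x : X) (a : A) : ‖𝒜.eval x a‖ ≤ ‖a‖ :=
  𝒜.norm_eval_le_of_sub_mem (by simp)

variable [T2Space X] [LocallyCompactSpace X]

theorem norm_le_of_isSelfAdjoint {b : A} (hb : IsSelfAdjoint b) {c : ℝ} (hc : 0 < c)
    (h : ∀ x, ‖𝒜.eval x b‖ < c) : ‖b‖ ≤ c := by
  choose U hU hxU hUg using fun x => 𝒜.exists_isOpen_of_norm_eval_lt (h x)
  obtain ⟨C, hC, hCg⟩ := 𝒜.exists_isCompact_act b hc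
  obtain ⟨D, hD, hCD, -⟩ := exists_compact_between hC isOpen_univ (Set.subset_univ C)
  obtain ⟨t, htD⟩ := hD.elim_finite_subcover U hU fun x _ => Set.mem_iUnion.mpr ⟨x, hxU x⟩
  let e := t.equivFin
  let s : Fin t.card → Set X := fun i => U (e.symm i)
  obtain ⟨f, hfs, hf1, hf01, hfc⟩ := exists_continuous_sum_one_of_isOpen_isCompact (s := s)
    (fun i => hU _) hD (by
      intro x hx
      obtain ⟨y, hy, hxy⟩ := Set.mem_iUnion₂.mp (htD hx)
      exact Set.mem_iUnion.mpr ⟨e ⟨y, hy⟩, by simpa [s] using hxy⟩)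
  have hk : ∀ i, ∃ k : C(X, ℝ), Set.EqOn k 1 (tsupport (f i)) ∧ Set.EqOn k 0 (s i)ᶜ ∧
      HasCompactSupport k ∧ ∀ x, k x ∈ Set.Icc (0 : ℝ) 1 := fun i =>
    exists_continuous_one_zero_of_isCompact (hfc i) (hU _).isClosed_compl
      (Set.disjoint_compl_right_iff_subset.mpr (hfs i))
  choose k hk1 hk0 hkc hk01 using hk
  obtain ⟨g, hg1, hg0, hgc, hg01⟩ := exists_continuous_one_zero_of_isCompact hC
    isOpen_interior.isClosed_compl (Set.disjoint_compl_right_iff_subset.mpr hCD)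
  let z' : Fin t.card → 𝓜(ℂ, A) := fun i => 𝒜.μ (ofReal (f i) (hfc i))
  let z : Option (Fin t.card) → 𝓜(ℂ, A) := fun o => o.elim (1 - ∑ i, z' i) z'
  let κ : Option (Fin t.card) → 𝓜(ℂ, A) := fun o =>
    o.elim (1 - 𝒜.μ (ofReal g hgc)) fun i => 𝒜.μ (ofReal (k i) (hkc i))
  have hb' : IsSelfAdjoint (b : 𝓜(ℂ, A)) := by
    have := map_star (coeHom (𝕜 := ℂ) (A := A)) b
    rw [hb.star_eq] at this
    exact this.symm
  rw [← norm_coe' b]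
  refine norm_le_of_partition hb' z κ ?_ ?_ ?_ hc ?_
  · rintro (_ | i)
    · exact (Commute.one_left _).sub_left (𝒜.central _ _)
    · exact 𝒜.central _ _
  · rw [Fintype.sum_option]; simp [z]
  · rintro (_ | i)
    · have : (∑ i, z' i) * 𝒜.μ (ofReal g hgc) = 𝒜.μ (ofReal g hgc) := by
        rw [← map_sum, ← map_mul]
        congr 1
        ext x
        by_cases hx : x ∈ D
        · have h1 : ∑ i, f i x = 1 := by simpa using hf1 hx
          have h2 : (∑ i, ofReal (f i) (hfc i)) x = ((∑ i, f i x : ℝ) : ℂ) := by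
            let ev : C₀(X, ℂ) →+ ℂ :=
              { toFun := fun F => F x, map_zero' := rfl, map_add' := fun _ _ => rfl }
            rw [Complex.ofReal_sum]
            exact map_sum ev _ _
          rw [ZeroAtInftyContinuousMap.mul_apply, h2, h1]; simp
        · have : ofReal g hgc x = 0 := by
            have : g x = 0 := hg0 fun hx' => hx (interior_subset hx')
            change (g x : ℂ) = 0
            simp [this]
          simp [this]
      simp [z, κ, sub_mul, mul_sub, this]
    · change z' i * 𝒜.μ (ofReal (k i) (hkc i)) = z' i
      rw [← map_mul]
      congr 1
      ext x
      by_cases hx : x ∈ tsupport (f i)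
      · have : k i x = 1 := hk1 i hx
        change (f i x : ℂ) * (k i x : ℂ) = f i x
        simp [this]
      · have : f i x = 0 := image_eq_zero_of_notMem_tsupport hx
        change (f i x : ℂ) * (k i x : ℂ) = f i x
        simp [this]
  · rintro (_ | i)
    · have : (κ none) * (b : 𝓜(ℂ, A)) = ((b - (𝒜.μ (ofReal g hgc)).fst b : A) : 𝓜(ℂ, A)) := by
        have := map_sub (coeHom (𝕜 := ℂ) (A := A)) b ((𝒜.μ (ofReal g hgc)).fst b)
        simp only [coeHom_apply] at this
        rw [this, ← mul_coe_eq]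
        simp [κ, sub_mul]
      rw [this, norm_coe']
      refine hCg _ (norm_ofReal_le hgc hg01) fun x hx => ?_
      have : g x = 1 := hg1 hx
      change (g x : ℂ) = 1
      simp [this]
    · change ‖𝒜.μ (ofReal (k i) (hkc i)) * (b : 𝓜(ℂ, A))‖ ≤ c
      rw [mul_coe_eq, norm_coe']
      refine hUg (e.symm i) _ (norm_ofReal_le _ (hk01 i)) fun x hx => ?_
      have : k i x = 0 := hk0 i hx
      change (k i x : ℂ) = 0
      simp [this]

theorem norm_le_of_forall_eval {a : A} {c : ℝ} (hc : 0 ≤ c)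
    (h : ∀ x ∈ 𝒜.support, ‖𝒜.eval x a‖ ≤ c) : ‖a‖ ≤ c := by
  refine le_of_forall_gt_imp_ge_of_dense fun d hd => ?_
  have hd0 : 0 < d := hc.trans_lt hd
  have h' : ∀ x, ‖𝒜.eval x a‖ < d := fun x => by
    by_cases hx : x ∈ 𝒜.support
    · exact (h x hx).trans_lt hd
    · have : 𝒜.eval x a = 0 := by
        rw [eval_eq_zero_iff, 𝒜.fibreIdeal_eq_top hx]; trivial
      rw [this]
      simpa using hd0
  have h2 : ‖star a * a‖ ≤ d * d := by
    refine 𝒜.norm_le_of_isSelfAdjoint (.star_mul_self a) (by positivity) fun x => ?_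
    obtain ⟨j, hj, hja⟩ := 𝒜.exists_mem_of_norm_eval_lt (h' x)
    refine (𝒜.norm_eval_le_of_sub_mem (b := star (a - j) * (a - j)) ?_).trans_lt ?_
    · have h3 : star a * a - star (a - j) * (a - j) = star (a - j) * j + star j * a := by
        rw [star_sub]; noncomm_ring
      rw [h3]
      refine add_mem ?_ ?_
      · exact 𝒜.fst_mem_fibreIdeal ((star (a - j) : A) : 𝓜(ℂ, A)) hj
      · exact 𝒜.snd_mem_fibreIdeal (a : 𝓜(ℂ, A)) (𝒜.star_mem_fibreIdeal hj)
    · rw [CStarRing.norm_star_mul_self]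
      exact mul_self_lt_mul_self (norm_nonneg _) hja
  rw [CStarRing.norm_star_mul_self] at h2
  nlinarith [norm_nonneg a]

theorem eq_zero_of_forall_mem {a : A} (h : ∀ x ∈ 𝒜.support, a ∈ 𝒜.fibreIdeal x) : a = 0 := by
  have : ‖a‖ ≤ 0 := 𝒜.norm_le_of_forall_eval le_rfl fun x hx => by
    rw [𝒜.eval_eq_zero_iff.mpr (h x hx)]; simp
  simpa using this

theorem isOpen_norm_eval_lt (a : A) (δ : ℝ) : IsOpen {x | ‖𝒜.eval x a‖ < δ} := by
  rw [isOpen_iff_forall_mem_open]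
  intro x hx
  obtain ⟨c, hxc, hcδ⟩ := exists_between (show ‖𝒜.eval x a‖ < δ from hx)
  obtain ⟨U, hU, hxU, hg⟩ := 𝒜.exists_isOpen_of_norm_eval_lt hxc
  obtain ⟨V, hV, hxV, hVU⟩ := exists_compact_subset hU hxU
  obtain ⟨k, hk1, hk0, hkc, hk01⟩ := exists_continuous_one_zero_of_isCompact hV hU.isClosed_compl
    (Set.disjoint_compl_right_iff_subset.mpr hVU)
  refine ⟨interior V, fun y hy => ?_, isOpen_interior, hxV⟩
  have h1 := hg _ (norm_ofReal_le hkc hk01) fun z hz => by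
    have : k z = 0 := hk0 hz
    change (k z : ℂ) = 0
    simp [this]
  refine (𝒜.norm_eval_le_of_sub_mem (b := (𝒜.μ (ofReal k hkc)).fst a) ?_).trans_lt
    (h1.trans_lt hcδ)
  have h2 := 𝒜.act_sub_mem (ofReal k hkc) y a
  have h3 : ofReal k hkc y = 1 := by
    have : k y = 1 := hk1 (interior_subset hy)
    change (k y : ℂ) = 1
    simp [this]
  rw [h3, one_smul] at h2
  simpa using neg_mem h2

theorem isCompact_le_norm_eval (a : A) {δ : ℝ} (hδ : 0 < δ) :
    IsCompact {x | δ ≤ ‖𝒜.eval x a‖} := by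
  obtain ⟨C, hC, hCg⟩ := 𝒜.exists_isCompact_act a (half_pos hδ)
  obtain ⟨g, hg1, -, hgc, hg01⟩ := exists_continuous_one_zero_of_isCompact hC isClosed_empty
    (Set.disjoint_empty C)
  refine hgc.of_isClosed_subset ?_ fun x hx => ?_
  · have : {x | δ ≤ ‖𝒜.eval x a‖} = {x | ‖𝒜.eval x a‖ < δ}ᶜ := by ext; simp
    rw [this]
    exact (𝒜.isOpen_norm_eval_lt a δ).isClosed_compl
  · by_contra hx'
    have h1 := hCg _ (norm_ofReal_le hgc hg01) fun x hx => by
      have : g x = 1 := hg1 hx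
      change (g x : ℂ) = 1
      simp [this]
    have h2 := 𝒜.norm_eval_le_of_sub_mem (x := x) (a := a)
      (b := a - (𝒜.μ (ofReal g hgc)).fst a) (by
        have h3 := 𝒜.act_sub_mem (ofReal g hgc) x a
        have h4 : ofReal g hgc x = 0 := by
          have : g x = 0 := image_eq_zero_of_notMem_tsupport hx'
          change (g x : ℂ) = 0
          simp [this]
        rw [h4, zero_smul, sub_zero] at h3
        simpa using h3)
    have : δ ≤ ‖𝒜.eval x a‖ := hx
    linarith

theorem exists_extension {X : Type*} [TopologicalSpace X] [T2Space X] [LocallyCompactSpace X]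
    {C : Set X} (hC : IsCompact C) (f : C(C, ℂ)) {c : ℝ} (hc : 0 < c) (hf : ∀ x, ‖f x‖ ≤ c) :
    ∃ F : C₀(X, ℂ), (∀ x : C, F x = f x) ∧ ∀ x, ‖F x‖ ≤ c := by
  have : CompactSpace C := isCompact_iff_compactSpace.mp hC
  have : TietzeExtension (Metric.closedBall (0 : ℂ) c) :=
    Metric.instTietzeExtensionClosedBall ℂ (0 : ℂ) hc
  let e : C → OnePoint X := fun x => ((x : X) : OnePoint X)
  have he : Topology.IsClosedEmbedding e :=
    (OnePoint.continuous_coe.comp continuous_subtype_val).isClosedEmbedding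
      (OnePoint.coe_injective.comp Subtype.val_injective)
  obtain ⟨G, hGn, hG⟩ := f.exists_extension_forall_mem he (t := Metric.closedBall (0 : ℂ) c)
    (fun x => by simpa using hf x)
  obtain ⟨k, hk1, -, hkc, hk01⟩ := exists_continuous_one_zero_of_isCompact hC isClosed_empty
    (Set.disjoint_empty C)
  refine ⟨⟨⟨fun x => G x * ofReal k hkc x, ?_⟩, ?_⟩, fun x => ?_, fun x => ?_⟩
  · exact (G.continuous.comp OnePoint.continuous_coe).mul (map_continuous _)
  · refine HasCompactSupport.is_zero_at_infty ?_
    exact (hkc.comp_left (g := fun r : ℝ => (r : ℂ)) (by simp)).mul_left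
  · have h1 : G (x : X) = f x := DFunLike.congr_fun hG x
    have h2 : ofReal k hkc (x : X) = 1 := by
      have : k (x : X) = 1 := hk1 x.2
      change (k (x : X) : ℂ) = 1
      simp [this]
    change G (x : X) * ofReal k hkc (x : X) = f x
    rw [h1, h2, mul_one]
  · change ‖G (x : X) * ofReal k hkc x‖ ≤ c
    rw [norm_mul]
    have h1 : ‖G (x : X)‖ ≤ c := by simpa using hGn (x : OnePoint X)
    nlinarith [norm_ofReal_le hkc hk01 x, norm_nonneg (G (x : X)), norm_nonneg (ofReal k hkc x)]

theorem exists_approx_section (f : 𝒜.support →ᵇ ℂ) (a : A) {ε : ℝ} (hε : 0 < ε) :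
    ∃ b : A, ∀ x : 𝒜.support, ‖𝒜.eval x (b - f x • a)‖ ≤ ε := by
  set c : ℝ := ‖f‖ + 1 with hc
  have hc0 : 0 < c := by positivity
  set δ : ℝ := ε / (2 * c) with hδ
  have hδ0 : 0 < δ := by positivity
  have hC := 𝒜.isCompact_le_norm_eval a hδ0
  have hCs : {x | δ ≤ ‖𝒜.eval x a‖} ⊆ 𝒜.support := fun x hx => by
    by_contra hx'
    have h0 : 𝒜.eval x a = 0 := by
      rw [eval_eq_zero_iff, 𝒜.fibreIdeal_eq_top hx']; trivial
    have h1 : δ ≤ ‖𝒜.eval x a‖ := hx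
    rw [h0, norm_zero] at h1
    linarith
  have hfb : ∀ x, ‖f x‖ ≤ c := fun x => (f.norm_coe_le_norm x).trans (by simp [hc])
  obtain ⟨F, hF, hFc⟩ := exists_extension hC
    ⟨fun x => f ⟨x, hCs x.2⟩, f.continuous.comp (by fun_prop)⟩ hc0 fun x => hfb _
  refine ⟨(𝒜.μ F).fst a, fun x => ?_⟩
  have h1 : 𝒜.eval x ((𝒜.μ F).fst a - f x • a) = (F x - f x) • 𝒜.eval x a := by
    have h2 : 𝒜.eval x ((𝒜.μ F).fst a - F x • a) = 0 :=
      𝒜.eval_eq_zero_iff.mpr (𝒜.act_sub_mem F x a)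
    have h3 : (𝒜.μ F).fst a - f x • a = ((𝒜.μ F).fst a - F x • a) + (F x - f x) • a := by
      rw [sub_smul]; abel
    rw [h3]
    simp only [eval] at h2 ⊢
    rw [map_add, h2, zero_add, map_smul]
  rw [h1, norm_smul]
  by_cases hx : δ ≤ ‖𝒜.eval x a‖
  · have : F x = f x := hF ⟨x, hx⟩
    simp [this, hε.le]
  · have h4 : ‖F x - f x‖ ≤ 2 * c := (norm_sub_le _ _).trans (by linarith [hFc x, hfb x])
    calc ‖F x - f x‖ * ‖𝒜.eval x a‖ ≤ 2 * c * δ := by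
          gcongr
          exact (not_le.mp hx).le
      _ = ε := by rw [hδ]; field_simp

/-- For `f` bounded continuous on `X_A` and `a ∈ A`, the section `x ↦ f x • a(x)` is given by an
element of `A`. -/
theorem exists_section_smul (f : 𝒜.support →ᵇ ℂ) (a : A) :
    ∃ b : A, ∀ x : 𝒜.support, b - f x • a ∈ 𝒜.fibreIdeal x := by
  choose b hb using fun n : ℕ => 𝒜.exists_approx_section f a (ε := (1 / 2) ^ n) (by positivity)
  have hsub : ∀ m n, ‖b m - b n‖ ≤ (1 / 2) ^ m + (1 / 2) ^ n := fun m n => by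
    refine 𝒜.norm_le_of_forall_eval (by positivity) fun x hx => ?_
    have : b m - b n = (b m - f ⟨x, hx⟩ • a) - (b n - f ⟨x, hx⟩ • a) := by abel
    rw [this]
    have h1 : 𝒜.eval x ((b m - f ⟨x, hx⟩ • a) - (b n - f ⟨x, hx⟩ • a)) =
      𝒜.eval x (b m - f ⟨x, hx⟩ • a) - 𝒜.eval x (b n - f ⟨x, hx⟩ • a) := map_sub _ _ _
    rw [h1]
    exact (norm_sub_le _ _).trans (add_le_add (hb m ⟨x, hx⟩) (hb n ⟨x, hx⟩))
  have hcau : CauchySeq b := by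
    refine cauchySeq_of_le_geometric (1 / 2) 2 (by norm_num) fun n => ?_
    rw [dist_eq_norm]
    refine (hsub n (n + 1)).trans ?_
    rw [pow_succ]
    have : (0 : ℝ) < (1 / 2) ^ n := by positivity
    linarith
  obtain ⟨l, hl⟩ := cauchySeq_tendsto_of_complete hcau
  refine ⟨l, fun x => ?_⟩
  refine 𝒜.mem_of_norm_eval_le_zero ?_
  have h1 : Filter.Tendsto (fun n => ‖l - b n‖ + (1 / 2 : ℝ) ^ n) Filter.atTop (nhds (0 + 0)) := by
    refine Filter.Tendsto.add ?_ (tendsto_pow_atTop_nhds_zero_of_lt_one (by norm_num) (by norm_num))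
    have := (tendsto_const_nhds (x := l)).sub hl
    simpa using this.norm
  rw [add_zero] at h1
  refine ge_of_tendsto' h1 fun n => ?_
  have h2 : l - f x • a = (l - b n) + (b n - f x • a) := by abel
  have h3 : 𝒜.eval x (l - f x • a) = 𝒜.eval x (l - b n) + 𝒜.eval x (b n - f x • a) := by
    rw [h2]; exact map_add _ _ _
  rw [h3]
  exact (norm_add_le _ _).trans (add_le_add (𝒜.norm_eval_le_norm _ _) (hb n x))

theorem eq_of_forall_sub_mem {a b : A} (c : 𝒜.support → A)
    (ha : ∀ x : 𝒜.support, a - c x ∈ 𝒜.fibreIdeal x)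
    (hb : ∀ x : 𝒜.support, b - c x ∈ 𝒜.fibreIdeal x) : a = b := by
  rw [← sub_eq_zero]
  refine 𝒜.eq_zero_of_forall_mem fun x hx => ?_
  have := sub_mem (ha ⟨x, hx⟩) (hb ⟨x, hx⟩)
  simpa using this

end Aux

section Multiplication

variable [T2Space X] [LocallyCompactSpace X] (𝒜 : C0Algebra X A)

/-- The element `f · a` of `A` with `(f · a)(x) = f x • a(x)` for all `x ∈ X_A`. -/
def sectionSMul (f : 𝒜.support →ᵇ ℂ) (a : A) : A := (𝒜.exists_section_smul f a).choose

theorem sectionSMul_spec (f : 𝒜.support →ᵇ ℂ) (a : A) (x : 𝒜.support) :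
    𝒜.sectionSMul f a - f x • a ∈ 𝒜.fibreIdeal x := (𝒜.exists_section_smul f a).choose_spec x

theorem sectionSMul_eq {f : 𝒜.support →ᵇ ℂ} {a b : A}
    (h : ∀ x : 𝒜.support, b - f x • a ∈ 𝒜.fibreIdeal x) : 𝒜.sectionSMul f a = b :=
  𝒜.eq_of_forall_sub_mem _ (𝒜.sectionSMul_spec f a) h

theorem norm_sectionSMul_le (f : 𝒜.support →ᵇ ℂ) (a : A) :
    ‖𝒜.sectionSMul f a‖ ≤ ‖f‖ * ‖a‖ := by
  refine 𝒜.norm_le_of_forall_eval (by positivity) fun x hx => ?_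
  refine (𝒜.norm_eval_le_of_sub_mem (𝒜.sectionSMul_spec f a ⟨x, hx⟩)).trans ?_
  rw [norm_smul]
  gcongr
  exact f.norm_coe_le_norm _

/-- `sectionSMul` as a bounded operator. -/
def sectionSMulCLM (f : 𝒜.support →ᵇ ℂ) : A →L[ℂ] A :=
  LinearMap.mkContinuous
    { toFun := 𝒜.sectionSMul f
      map_add' := fun a b => 𝒜.sectionSMul_eq fun x => by
        have := add_mem (𝒜.sectionSMul_spec f a x) (𝒜.sectionSMul_spec f b x)
        rw [smul_add]
        convert! this using 1
        abel
      map_smul' := fun c a => 𝒜.sectionSMul_eq fun x => by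
        have := Submodule.smul_mem _ c (𝒜.sectionSMul_spec f a x)
        rw [smul_sub, smul_comm] at this
        exact this } ‖f‖ (𝒜.norm_sectionSMul_le f)

/-- The multiplier of `A` given by multiplication of sections by `f`. -/
def sectionMultiplier (f : 𝒜.support →ᵇ ℂ) : 𝓜(ℂ, A) where
  toProd := (𝒜.sectionSMulCLM f, 𝒜.sectionSMulCLM f)
  central a b := by
    refine 𝒜.eq_of_forall_sub_mem (fun x => f x • (a * b)) (fun x => ?_) fun x => ?_
    · have := 𝒜.snd_mem_fibreIdeal (b : 𝓜(ℂ, A)) (𝒜.sectionSMul_spec f a x)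
      simp only [coe_snd, ContinuousLinearMap.flip_apply, ContinuousLinearMap.mul_apply', sub_mul,
        smul_mul_assoc] at this
      exact this
    · have := 𝒜.fst_mem_fibreIdeal (a : 𝓜(ℂ, A)) (𝒜.sectionSMul_spec f b x)
      simp only [coe_fst, ContinuousLinearMap.mul_apply', mul_sub, mul_smul_comm] at this
      exact this

theorem sectionMultiplier_central (f : 𝒜.support →ᵇ ℂ) (m : 𝓜(ℂ, A)) :
    Commute (𝒜.sectionMultiplier f) m := by
  refine ext_fst fun a => ?_
  change 𝒜.sectionSMul f (m.fst a) = m.fst (𝒜.sectionSMul f a)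
  refine 𝒜.sectionSMul_eq fun x => ?_
  rw [← map_smul, ← map_sub]
  exact 𝒜.fst_mem_fibreIdeal m (𝒜.sectionSMul_spec f a x)

/-- The *-homomorphism from the bounded continuous functions on `X_A` into the centre of the
multiplier algebra of `A` given by pointwise multiplication of sections. -/
def sectionHom : (𝒜.support →ᵇ ℂ) →⋆ₙₐ[ℂ] 𝓜(ℂ, A) where
  toFun := 𝒜.sectionMultiplier
  map_smul' c f := ext_fst fun a => 𝒜.sectionSMul_eq fun x => by
    have := Submodule.smul_mem _ c (𝒜.sectionSMul_spec f a x)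
    rw [smul_sub, smul_smul] at this
    exact this
  map_zero' := ext_fst fun a => 𝒜.sectionSMul_eq fun x => by simp
  map_add' f g := ext_fst fun a => 𝒜.sectionSMul_eq fun x => by
    have := add_mem (𝒜.sectionSMul_spec f a x) (𝒜.sectionSMul_spec g a x)
    rw [sub_add_sub_comm, ← add_smul] at this
    exact this
  map_mul' f g := ext_fst fun a => 𝒜.sectionSMul_eq fun x => by
    have := add_mem (𝒜.sectionSMul_spec f (𝒜.sectionSMul g a) x)
      (Submodule.smul_mem _ (f x) (𝒜.sectionSMul_spec g a x))
    rw [smul_sub, smul_smul, sub_add_sub_cancel] at this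
    exact this
  map_star' f := ext_fst fun a => 𝒜.sectionSMul_eq fun x => by
    have := 𝒜.star_mem_fibreIdeal (𝒜.sectionSMul_spec f (star a) x)
    rw [star_sub, star_smul, star_star] at this
    rw [star_fst]
    exact this

/-- The defining property of `sectionHom`: `(f · a)(x) = f x • a(x)` for all `x ∈ X_A`. -/
theorem eval_sectionHom (f : 𝒜.support →ᵇ ℂ) (a : A) (x : 𝒜.support) :
    𝒜.eval x ((𝒜.sectionHom f).fst a) = f x • 𝒜.eval x a := by
  have : 𝒜.eval x ((𝒜.sectionHom f).fst a - f x • a) = 0 :=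
    𝒜.eval_eq_zero_iff.mpr (𝒜.sectionSMul_spec f a x)
  rw [← sub_eq_zero, ← this]
  simp only [eval, map_sub, map_smul]

/-- `sectionHom` extends the structure map `μ_A`. -/
theorem sectionHom_restrict (f : C₀(X, ℂ)) :
    𝒜.sectionHom (f.toBCF.compContinuous ⟨Subtype.val, continuous_subtype_val⟩) = 𝒜.μ f :=
  ext_fst fun a => 𝒜.sectionSMul_eq fun x => 𝒜.act_sub_mem f x a

theorem sectionHom_one : 𝒜.sectionHom 1 = 1 :=
  ext_fst fun a => 𝒜.sectionSMul_eq fun x => by simp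

end Multiplication

/-! ### Change of the base space -/

section BaseChange

variable {K L : Type*} [TopologicalSpace K] [CompactSpace K] [TopologicalSpace L] [CompactSpace L]

/-- The *-homomorphism `f ↦ f ∘ ι` from `C(K)` to the bounded continuous functions on `S`, for a
continuous map `ι : S → K` into a compact space. -/
def pullback {S : Type*} [TopologicalSpace S] (ι : C(S, K)) : C₀(K, ℂ) →⋆ₙₐ[ℂ] (S →ᵇ ℂ) where
  toFun f := f.toBCF.compContinuous ι
  map_smul' _ _ := rfl
  map_zero' := rfl
  map_add' _ _ := rfl
  map_mul' _ _ := rfl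
  map_star' _ := rfl

/-- The *-homomorphism `f ↦ f ∘ p` from `C(K)` to `C(L)`, for a continuous map `p : L → K` of
compact spaces. -/
def pullbackC₀ (p : C(L, K)) : C₀(K, ℂ) →⋆ₙₐ[ℂ] C₀(L, ℂ) where
  toFun f := ZeroAtInftyContinuousMap.ContinuousMap.liftZeroAtInfty ((f : C(K, ℂ)).comp p)
  map_smul' _ _ := rfl
  map_zero' := rfl
  map_add' _ _ := rfl
  map_mul' _ _ := rfl
  map_star' _ := rfl

/-- On a compact space a *-homomorphism into the centre of the multiplier algebra which maps the
constant function `1` to `1` gives a `C(K)`-algebra. -/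
def ofUnital (μ : C₀(K, ℂ) →⋆ₙₐ[ℂ] 𝓜(ℂ, A)) (central : ∀ f m, Commute (μ f) m)
    (one : μ (ZeroAtInftyContinuousMap.ContinuousMap.liftZeroAtInfty 1) = 1) : C0Algebra K A where
  μ := μ
  central := central
  nondegenerate := by
    refine top_unique fun a _ => Submodule.le_topologicalClosure _ (Submodule.subset_span
      ⟨ZeroAtInftyContinuousMap.ContinuousMap.liftZeroAtInfty 1, a, ?_⟩)
    rw [one]; rfl

/-- Let `ι : X_A → K` be a continuous map into a compact space (for instance a compactification of
`X_A`). Then `A` becomes a `C(K)`-algebra, its structure map `μ_A^K` being determined by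
`(μ_A^K(f) a)(x) = f (ι x) • a(x)` for `x ∈ X_A`; in terms of base maps, `φ_A : Prim A → X_A` is
replaced by `ι ∘ φ_A`. -/
def baseChange [T2Space X] [LocallyCompactSpace X] (𝒜 : C0Algebra X A) (ι : C(𝒜.support, K)) :
    C0Algebra K A :=
  ofUnital (𝒜.sectionHom.comp (pullback ι)) (fun _ _ => 𝒜.sectionMultiplier_central _ _)
    𝒜.sectionHom_one

/-- If `p : L → K` is a continuous map of compact spaces, every `C(L)`-algebra is a
`C(K)`-algebra through the *-homomorphism `C(K) → C(L)`, `f ↦ f ∘ p`. -/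
def restrictBase (𝒜 : C0Algebra L A) (p : C(L, K)) : C0Algebra K A where
  μ := 𝒜.μ.comp (pullbackC₀ p)
  central _ _ := 𝒜.central _ _
  nondegenerate := by
    refine top_unique ?_
    rw [← 𝒜.nondegenerate]
    refine Submodule.topologicalClosure_mono (Submodule.span_mono ?_)
    rintro _ ⟨f, a, rfl⟩
    refine ⟨ZeroAtInftyContinuousMap.ContinuousMap.liftZeroAtInfty 1, (𝒜.μ f).fst a, ?_⟩
    change (𝒜.μ (ZeroAtInftyContinuousMap.ContinuousMap.liftZeroAtInfty 1)).fst ((𝒜.μ f).fst a) = _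
    have h1 : ZeroAtInftyContinuousMap.ContinuousMap.liftZeroAtInfty 1 * f = f := by
      ext x
      exact one_mul (f x)
    rw [act_act, h1]

variable [T2Space X] [LocallyCompactSpace X] (𝒜 : C0Algebra X A)

theorem eval_baseChange (ι : C(𝒜.support, K)) (f : C₀(K, ℂ)) (a : A) (x : 𝒜.support) :
    𝒜.eval x (((𝒜.baseChange ι).μ f).fst a) = f (ι x) • 𝒜.eval x a :=
  𝒜.eval_sectionHom _ a x

/-- For `x ∈ X_A` the ideal `J_x`, and hence the fibre at `x`, does not depend on the ambient
space of `X_A`. -/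
theorem fibreIdeal_baseChange [T2Space K] {ι : C(𝒜.support, K)} (hι : Topology.IsEmbedding ι)
    (x : 𝒜.support) : (𝒜.baseChange ι).fibreIdeal (ι x) = 𝒜.fibreIdeal x := by
  refine le_antisymm ?_ ?_
  · refine Submodule.topologicalClosure_minimal _ ?_ (𝒜.isClosed_fibreIdeal x)
    refine Submodule.span_le.mpr ?_
    rintro _ ⟨f, a, hf, rfl⟩
    have := 𝒜.eval_baseChange ι f a x
    rw [hf, zero_smul, eval_eq_zero_iff] at this
    exact this
  · refine Submodule.topologicalClosure_minimal _ ?_ ((𝒜.baseChange ι).isClosed_fibreIdeal _)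
    refine Submodule.span_le.mpr ?_
    rintro _ ⟨f, a, hf, rfl⟩
    rw [← ((𝒜.baseChange ι).isClosed_fibreIdeal _).closure_eq, Metric.mem_closure_iff]
    intro ε hε
    set δ := ε / (2 * (‖a‖ + 1)) with hδ
    have hpos : 0 < ‖a‖ + 1 := by positivity
    have hδ0 : 0 < δ := by positivity
    have hO : IsOpen {y : 𝒜.support | ‖f y‖ < δ} := isOpen_lt (by fun_prop) continuous_const
    obtain ⟨W, hW, hWO⟩ := hι.isOpen_iff.mp hO
    have hxW : ι x ∈ W := by
      have : x ∈ ι ⁻¹' W := by rw [hWO]; simpa [hf] using hδ0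
      exact this
    obtain ⟨k, hk1, hk0, hkc, hk01⟩ := exists_continuous_one_zero_of_isCompact
      (isCompact_singleton (x := ι x)) hW.isClosed_compl
      (by simpa using hxW)
    set g : C₀(K, ℂ) := ZeroAtInftyContinuousMap.ContinuousMap.liftZeroAtInfty 1 - ofReal k hkc with hg
    have hgv : ∀ y, g y = 1 - (k y : ℂ) := fun y => rfl
    refine ⟨((𝒜.baseChange ι).μ g).fst ((𝒜.μ f).fst a),
      Submodule.le_topologicalClosure _ (Submodule.subset_span ⟨g, _, ?_, rfl⟩), ?_⟩
    · rw [hgv, hk1 (Set.mem_singleton _)]; simp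
    · rw [dist_eq_norm]
      have : δ * ‖a‖ < ε := by
        rw [hδ, div_mul_eq_mul_div, div_lt_iff₀ (by positivity)]
        nlinarith [norm_nonneg a]
      refine (𝒜.norm_le_of_forall_eval (c := δ * ‖a‖) (by positivity) fun y hy => ?_).trans_lt this
      have e1 : 𝒜.eval y ((𝒜.μ f).fst a) = f y • 𝒜.eval y a := by
        have : 𝒜.eval y ((𝒜.μ f).fst a - f y • a) = 0 :=
          𝒜.eval_eq_zero_iff.mpr (𝒜.act_sub_mem f y a)
        rw [← sub_eq_zero, ← this]
        simp only [eval, map_sub, map_smul]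
      have e2 := 𝒜.eval_baseChange ι g ((𝒜.μ f).fst a) ⟨y, hy⟩
      have e3 : 𝒜.eval y ((𝒜.μ f).fst a - ((𝒜.baseChange ι).μ g).fst ((𝒜.μ f).fst a)) =
          ((k (ι ⟨y, hy⟩) : ℂ) * f y) • 𝒜.eval y a := by
        have : 𝒜.eval y ((𝒜.μ f).fst a - ((𝒜.baseChange ι).μ g).fst ((𝒜.μ f).fst a)) =
          𝒜.eval y ((𝒜.μ f).fst a) - 𝒜.eval y (((𝒜.baseChange ι).μ g).fst ((𝒜.μ f).fst a)) :=
          map_sub _ _ _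
        rw [this, e2, e1, hgv, smul_smul, ← sub_smul]
        congr 1
        ring
      rw [e3, norm_smul]
      refine mul_le_mul ?_ (𝒜.norm_eval_le_norm _ _) (norm_nonneg _) hδ0.le
      rw [norm_mul, Complex.norm_real, Real.norm_eq_abs, abs_of_nonneg (hk01 _).1]
      by_cases hyW : ι ⟨y, hy⟩ ∈ W
      · have h1 : ‖f y‖ < δ := by
          have : (⟨y, hy⟩ : 𝒜.support) ∈ ι ⁻¹' W := hyW
          rw [hWO] at this
          exact this
        nlinarith [(hk01 (ι ⟨y, hy⟩)).1, (hk01 (ι ⟨y, hy⟩)).2, norm_nonneg (f y)]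
      · have : k (ι ⟨y, hy⟩) = 0 := hk0 hyW
        rw [this]; simpa using hδ0.le

end BaseChange

/-! ### The algebra `A^β` -/

section Beta

variable [T2Space X] [LocallyCompactSpace X] (𝒜 : C0Algebra X A)

/-- The canonical map `X_A → βX`. -/
def toBetaX : C(𝒜.support, StoneCech X) :=
  ⟨fun x => stoneCechUnit (x : X), continuous_stoneCechUnit.comp continuous_subtype_val⟩

/-- The unital *-homomorphism `μ_{M(A)} : C(βX) → Z(M(A))` which extends `μ_A`; it is given by
`(μ_{M(A)}(f) a)(x) = f x • a(x)` for `x ∈ X_A`. -/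
def μM : C₀(StoneCech X, ℂ) →⋆ₙₐ[ℂ] 𝓜(ℂ, A) := (𝒜.baseChange 𝒜.toBetaX).μ

/-- The ideal `H_y = μ_{M(A)}({f ∈ C(βX) : f y = 0}) M(A)` of `M(A)`. -/
def idealH (y : StoneCech X) : Submodule ℂ 𝓜(ℂ, A) :=
  (Submodule.span ℂ {n : 𝓜(ℂ, A) | ∃ f m, f y = 0 ∧ 𝒜.μM f * m = n}).topologicalClosure

/-- The subspace `A + H_x` of `M(A)`. -/
def addIdealH (x : X) : Submodule ℂ 𝓜(ℂ, A) :=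
  LinearMap.range (LinearMapClass.linearMap (coeHom (𝕜 := ℂ) (A := A))) ⊔
    𝒜.idealH (stoneCechUnit x)

theorem isClosed_idealH (y : StoneCech X) : IsClosed (𝒜.idealH y : Set 𝓜(ℂ, A)) :=
  Submodule.isClosed_topologicalClosure _

theorem mul_mem_idealH {y : StoneCech X} (n : 𝓜(ℂ, A)) {m : 𝓜(ℂ, A)} (hm : m ∈ 𝒜.idealH y) :
    n * m ∈ 𝒜.idealH y := by
  have : 𝒜.idealH y ≤ (𝒜.idealH y).comap (LinearMap.mulLeft ℂ n) := by
    refine Submodule.topologicalClosure_minimal _ ?_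
      ((𝒜.isClosed_idealH y).preimage (continuous_const_mul n))
    refine Submodule.span_le.mpr ?_
    rintro _ ⟨f, m, hf, rfl⟩
    refine Submodule.le_topologicalClosure _ (Submodule.subset_span ⟨f, n * m, hf, ?_⟩)
    rw [LinearMap.mulLeft_apply, ← mul_assoc, ← mul_assoc]
    congr 1
    exact (𝒜.baseChange 𝒜.toBetaX).central f n
  exact this hm

theorem mem_idealH_mul {y : StoneCech X} (n : 𝓜(ℂ, A)) {m : 𝓜(ℂ, A)} (hm : m ∈ 𝒜.idealH y) :
    m * n ∈ 𝒜.idealH y := by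
  have : 𝒜.idealH y ≤ (𝒜.idealH y).comap (LinearMap.mulRight ℂ n) := by
    refine Submodule.topologicalClosure_minimal _ ?_
      ((𝒜.isClosed_idealH y).preimage (continuous_mul_const n))
    refine Submodule.span_le.mpr ?_
    rintro _ ⟨f, m, hf, rfl⟩
    refine Submodule.le_topologicalClosure _ (Submodule.subset_span ⟨f, m * n, hf, ?_⟩)
    rw [LinearMap.mulRight_apply, mul_assoc]
  exact this hm

theorem star_mem_idealH {y : StoneCech X} {m : 𝓜(ℂ, A)} (hm : m ∈ 𝒜.idealH y) :
    star m ∈ 𝒜.idealH y := by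
  let T : 𝓜(ℂ, A) →ₛₗ[starRingEnd ℂ] 𝓜(ℂ, A) :=
    { toFun := star, map_add' := star_add, map_smul' := star_smul }
  have : 𝒜.idealH y ≤ (𝒜.idealH y).comap T := by
    refine Submodule.topologicalClosure_minimal _ ?_
      ((𝒜.isClosed_idealH y).preimage continuous_star)
    refine Submodule.span_le.mpr ?_
    rintro _ ⟨f, m, hf, rfl⟩
    refine Submodule.le_topologicalClosure _
      (Submodule.subset_span ⟨star f, star m, by simp [hf], ?_⟩)
    change _ = star (𝒜.μM f * m)
    rw [star_mul, map_star]
    rw [← map_star]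
    exact (𝒜.baseChange 𝒜.toBetaX).central _ _
  exact this hm

theorem mem_addIdealH {x : X} {m : 𝓜(ℂ, A)} :
    m ∈ 𝒜.addIdealH x ↔ ∃ a : A, ∃ h ∈ 𝒜.idealH (stoneCechUnit x), (a : 𝓜(ℂ, A)) + h = m := by
  rw [addIdealH, Submodule.mem_sup]
  constructor
  · rintro ⟨_, ⟨a, rfl⟩, h, hh, rfl⟩
    exact ⟨a, h, hh, rfl⟩
  · rintro ⟨a, h, hh, rfl⟩
    exact ⟨_, ⟨a, rfl⟩, h, hh, rfl⟩

theorem mul_mem_addIdealH {x : X} (n : 𝓜(ℂ, A)) {m : 𝓜(ℂ, A)} (hm : m ∈ 𝒜.addIdealH x) :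
    n * m ∈ 𝒜.addIdealH x := by
  obtain ⟨a, h, hh, rfl⟩ := 𝒜.mem_addIdealH.mp hm
  rw [mul_add, mul_coe_eq]
  exact 𝒜.mem_addIdealH.mpr ⟨_, _, 𝒜.mul_mem_idealH n hh, rfl⟩

theorem mem_addIdealH_mul {x : X} (n : 𝓜(ℂ, A)) {m : 𝓜(ℂ, A)} (hm : m ∈ 𝒜.addIdealH x) :
    m * n ∈ 𝒜.addIdealH x := by
  obtain ⟨a, h, hh, rfl⟩ := 𝒜.mem_addIdealH.mp hm
  rw [add_mul, coe_mul_eq]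
  exact 𝒜.mem_addIdealH.mpr ⟨_, _, 𝒜.mem_idealH_mul n hh, rfl⟩

theorem star_mem_addIdealH {x : X} {m : 𝓜(ℂ, A)} (hm : m ∈ 𝒜.addIdealH x) :
    star m ∈ 𝒜.addIdealH x := by
  obtain ⟨a, h, hh, rfl⟩ := 𝒜.mem_addIdealH.mp hm
  rw [star_add]
  refine 𝒜.mem_addIdealH.mpr ⟨star a, _, 𝒜.star_mem_idealH hh, ?_⟩
  congr 1
  exact map_star (coeHom (𝕜 := ℂ) (A := A)) a

theorem isClosed_addIdealH (x : X) : IsClosed (𝒜.addIdealH x : Set 𝓜(ℂ, A)) := by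
  set H := 𝒜.idealH (stoneCechUnit x) with hH
  have hHc : IsClosed (H : Set 𝓜(ℂ, A)) := 𝒜.isClosed_idealH _
  let T : NormedAddGroupHom A (𝓜(ℂ, A) ⧸ H) :=
    { toFun := fun a => H.mkQ (a : 𝓜(ℂ, A))
      map_add' := fun a b => by
        have := map_add (coeHom (𝕜 := ℂ) (A := A)) a b
        simp only [coeHom_apply] at this
        rw [this, map_add]
      bound' := ⟨1, fun a => by
        rw [one_mul, ← norm_coe' a]
        exact Submodule.Quotient.norm_mk_le _ _⟩ }
  have key : T.SurjectiveOnWith T.range 2 := by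
    rintro _ ⟨a, rfl⟩
    rcases (norm_nonneg (T a)).eq_or_lt with h0 | hpos
    · refine ⟨0, ?_, by simp⟩
      rw [map_zero]
      exact (norm_eq_zero.mp h0.symm).symm
    · let _ := CStarAlgebra.spectralOrder A
      have _ := CStarAlgebra.spectralOrderedRing A
      have hu := CStarAlgebra.increasingApproximateUnit A
      have hlt : ‖T a‖ < 3 / 2 * ‖T a‖ := by linarith
      obtain ⟨m, hm, hmc⟩ := QuotientAddGroup.norm_lt_iff.mp hlt
      have hmH : (a : 𝓜(ℂ, A)) - m ∈ H := by
        rw [← Submodule.Quotient.eq]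
        exact hm.symm
      have _ := hu.neBot
      have e1 := Metric.tendsto_nhds.mp (hu.tendsto_mul_right a) (‖T a‖ / 2) (by positivity)
      obtain ⟨u, hu1, hu2⟩ := (e1.and hu.eventually_norm).exists
      have hw : (((a - u * a) + m.snd u : A) : 𝓜(ℂ, A)) =
          (a : 𝓜(ℂ, A)) - (u : 𝓜(ℂ, A)) * ((a : 𝓜(ℂ, A)) - m) := by
        rw [mul_sub, coe_mul_eq m u, mul_coe_eq, coe_fst, ContinuousLinearMap.mul_apply']
        simp only [← coeHom_apply, map_add, map_sub]
        abel
      refine ⟨(a - u * a) + m.snd u, ?_, ?_⟩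
      · change H.mkQ _ = H.mkQ _
        rw [hw, map_sub, sub_eq_self, Submodule.mkQ_apply, Submodule.Quotient.mk_eq_zero]
        exact 𝒜.mul_mem_idealH _ hmH
      · have e2 : ‖m.snd u‖ ≤ ‖m‖ := by
          have := m.snd.le_opNorm u
          rw [norm_snd] at this
          nlinarith [norm_nonneg m]
        have e3 : ‖a - u * a‖ < ‖T a‖ / 2 := by
          rw [dist_comm, dist_eq_norm] at hu1
          exact hu1
        refine (norm_add_le _ _).trans ?_
        change _ ≤ 2 * ‖T a‖
        linarith
  have h2 := controlled_closure_of_complete two_pos one_pos key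
  have hsub : (𝒜.addIdealH x : Set 𝓜(ℂ, A)) = H.mkQ ⁻¹' (T.range : Set (𝓜(ℂ, A) ⧸ H)) := by
    ext m
    rw [SetLike.mem_coe, mem_addIdealH]
    constructor
    · rintro ⟨a, h, hh, rfl⟩
      refine ⟨a, ?_⟩
      change H.mkQ _ = H.mkQ _
      rw [map_add, Submodule.mkQ_apply H h, (Submodule.Quotient.mk_eq_zero H).mpr hh, add_zero]
    · rintro ⟨a, ha⟩
      refine ⟨a, m - a, ?_, by abel⟩
      exact (Submodule.Quotient.eq H).mp (Eq.symm ha)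
  rw [hsub]
  refine IsClosed.preimage continuous_quot_mk ?_
  refine isClosed_of_closure_subset fun q hq => ?_
  obtain ⟨a, ha, -⟩ := h2 q hq
  exact ⟨a, ha⟩

/-- The C*-algebra `A^β = ⋂_{x ∈ X_A} (A + H_x)`, a closed ideal of `M(A)`. -/
def beta : NonUnitalStarSubalgebra ℂ 𝓜(ℂ, A) where
  carrier := {m | ∀ x ∈ 𝒜.support, m ∈ 𝒜.addIdealH x}
  add_mem' h h' x hx := add_mem (h x hx) (h' x hx)
  zero_mem' _ _ := zero_mem _
  mul_mem' _ h' x hx := 𝒜.mul_mem_addIdealH _ (h' x hx)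
  smul_mem' c _ h x hx := Submodule.smul_mem _ c (h x hx)
  star_mem' h x hx := 𝒜.star_mem_addIdealH (h x hx)

instance isClosed_beta : IsClosed (𝒜.beta : Set 𝓜(ℂ, A)) := by
  have : (𝒜.beta : Set 𝓜(ℂ, A)) = ⋂ x ∈ 𝒜.support, (𝒜.addIdealH x : Set 𝓜(ℂ, A)) := by
    ext m
    simp only [Set.mem_iInter, SetLike.mem_coe]
    rfl
  rw [this]
  exact isClosed_biInter fun x _ => 𝒜.isClosed_addIdealH x

theorem coe_mem_beta (a : A) : (a : 𝓜(ℂ, A)) ∈ 𝒜.beta :=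
  fun _ _ => 𝒜.mem_addIdealH.mpr ⟨a, 0, zero_mem _, add_zero _⟩

theorem mul_mem_beta (m : 𝓜(ℂ, A)) {n : 𝓜(ℂ, A)} (hn : n ∈ 𝒜.beta) : m * n ∈ 𝒜.beta :=
  fun x hx => 𝒜.mul_mem_addIdealH m (hn x hx)

theorem mem_beta_mul (m : 𝓜(ℂ, A)) {n : 𝓜(ℂ, A)} (hn : n ∈ 𝒜.beta) : n * m ∈ 𝒜.beta :=
  fun x hx => 𝒜.mem_addIdealH_mul m (hn x hx)

/-- A multiplier of `A` acts by multiplication on the ideal `A^β` of `M(A)`; this is the canonical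
embedding `M(A) → M(A^β)`. -/
def multiplierOfBeta : 𝓜(ℂ, A) →⋆ₙₐ[ℂ] 𝓜(ℂ, 𝒜.beta) where
  toFun m :=
    { toProd :=
        (LinearMap.mkContinuous
          { toFun := fun b => ⟨m * b, 𝒜.mul_mem_beta m b.2⟩
            map_add' := fun b c => Subtype.ext (mul_add _ _ _)
            map_smul' := fun r b => Subtype.ext (mul_smul_comm _ _ _) } ‖m‖
          (fun b => norm_mul_le m (b : 𝓜(ℂ, A))),
        LinearMap.mkContinuous
          { toFun := fun b => ⟨b * m, 𝒜.mem_beta_mul m b.2⟩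
            map_add' := fun b c => Subtype.ext (add_mul _ _ _)
            map_smul' := fun r b => Subtype.ext (smul_mul_assoc _ _ _) } ‖m‖
          (fun b => (norm_mul_le (b : 𝓜(ℂ, A)) m).trans_eq (mul_comm _ _)))
      central := fun b c => Subtype.ext (mul_assoc _ _ _) }
  map_smul' r m := ext_fst fun b => Subtype.ext (smul_mul_assoc _ _ _)
  map_zero' := ext_fst fun b => Subtype.ext (zero_mul _)
  map_add' m n := ext_fst fun b => Subtype.ext (add_mul _ _ _)
  map_mul' m n := ext_fst fun b => Subtype.ext (mul_assoc _ _ _)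
  map_star' m := ext_fst fun b => Subtype.ext (by
    rw [star_fst]
    change star m * (b : 𝓜(ℂ, A)) = star (star (b : 𝓜(ℂ, A)) * m)
    rw [star_mul, star_star])

theorem coe_multiplierOfBeta_fst (m : 𝓜(ℂ, A)) (b : 𝒜.beta) :
    (((𝒜.multiplierOfBeta m).fst b : 𝒜.beta) : 𝓜(ℂ, A)) = m * b := rfl

theorem coe_multiplierOfBeta_snd (m : 𝓜(ℂ, A)) (b : 𝒜.beta) :
    (((𝒜.multiplierOfBeta m).snd b : 𝒜.beta) : 𝓜(ℂ, A)) = b * m := rfl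

theorem multiplierOfBeta_central {z : 𝓜(ℂ, A)} (hz : ∀ m, Commute z m) (n : 𝓜(ℂ, 𝒜.beta)) :
    Commute (𝒜.multiplierOfBeta z) n := by
  refine ext_fst fun b => ?_
  change (𝒜.multiplierOfBeta z).fst (n.fst b) = n.fst ((𝒜.multiplierOfBeta z).fst b)
  have h : ∀ c : 𝒜.beta,
      c * ((𝒜.multiplierOfBeta z).fst (n.fst b) - n.fst ((𝒜.multiplierOfBeta z).fst b)) = 0 := by
    intro c
    rw [mul_sub, ← n.central, sub_eq_zero]
    have h1 : n.snd c * b = c * n.fst b := n.central c b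
    have h2 := congrArg (fun t : 𝒜.beta => z * (t : 𝓜(ℂ, A))) h1
    refine Subtype.ext ?_
    change (c : 𝓜(ℂ, A)) * (z * (n.fst b : 𝒜.beta)) = (n.snd c : 𝒜.beta) * (z * (b : 𝓜(ℂ, A)))
    rw [← mul_assoc, ← (hz _).eq, mul_assoc, ← mul_assoc _ z, ← (hz _).eq, mul_assoc]
    exact h2.symm
  have h0 := h (star ((𝒜.multiplierOfBeta z).fst (n.fst b) -
    n.fst ((𝒜.multiplierOfBeta z).fst b)))
  exact sub_eq_zero.mp ((CStarRing.star_mul_self_eq_zero_iff _).mp h0)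

/-- The canonical map `X_A → βX_A`. -/
def toBeta : C(𝒜.support, StoneCech 𝒜.support) := ⟨stoneCechUnit, continuous_stoneCechUnit⟩

/-- The `C(βX_A)`-algebra `(A^β, βX_A, μ_{A^β})`: a function `f ∈ C(βX_A)` acts on `A^β ⊆ M(A)` as
multiplication by the central multiplier `ν_A(f)` of `A`, where `ν_A` is the structure map of `A` as
a `C(βX_A)`-algebra. -/
def betaAlgebra : C0Algebra (StoneCech 𝒜.support) 𝒜.beta :=
  ofUnital (𝒜.multiplierOfBeta.comp (𝒜.baseChange 𝒜.toBeta).μ)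
    (fun f => 𝒜.multiplierOfBeta_central ((𝒜.baseChange 𝒜.toBeta).central f)) (by
      have h : (𝒜.baseChange 𝒜.toBeta).μ
          (ZeroAtInftyContinuousMap.ContinuousMap.liftZeroAtInfty 1) = 1 := 𝒜.sectionHom_one
      refine ext_fst fun b => Subtype.ext ?_
      rw [NonUnitalStarAlgHom.comp_apply, h, coe_multiplierOfBeta_fst, one_mul]
      rfl)

/-- The continuous extension `βX_A → K` of a continuous map from `X_A` to a compact Hausdorff
space. -/
def betaExtend {K : Type*} [TopologicalSpace K] [CompactSpace K] [T2Space K]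
    (ι : C(𝒜.support, K)) : C(StoneCech 𝒜.support, K) :=
  ⟨stoneCechExtend ι.continuous, continuous_stoneCechExtend ι.continuous⟩

/-- The `C(K)`-algebra `(A^β, K, μ_{A^β}^K)` for a compactification `K` of `X_A`: the structure map is
the restriction of `μ_{A^β}` to `C(K) ⊆ C(βX_A)`. -/
def betaAlgebraOver {K : Type*} [TopologicalSpace K] [CompactSpace K] [T2Space K]
    (ι : C(𝒜.support, K)) : C0Algebra K 𝒜.beta :=
  𝒜.betaAlgebra.restrictBase (𝒜.betaExtend ι)

end Beta

/-! ### Morphisms and compactifications -/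

/-- A morphism `(Ψ, ψ) : (A, X, μ_A) → (B, Y, μ_B)`. -/
structure Morphism {Y B : Type*} [TopologicalSpace Y] [NonUnitalCStarAlgebra B]
    (𝒜 : C0Algebra X A) (ℬ : C0Algebra Y B) where
  Ψ : A →⋆ₙₐ[ℂ] B
  ψ : C₀(X, ℂ) →⋆ₙₐ[ℂ] C₀(Y, ℂ)
  map_act : ∀ f a, Ψ ((𝒜.μ f).fst a) = (ℬ.μ (ψ f)).fst (Ψ a)

namespace Morphism

variable {Y B : Type*} [TopologicalSpace Y] [NonUnitalCStarAlgebra B]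
  {𝒜 : C0Algebra X A} {ℬ : C0Algebra Y B}

/-- `x = ψ^*(y)`: evaluation at `y` composed with `ψ` is evaluation at `x`. For `X` locally compact
Hausdorff there is such an `x` exactly when `y` lies in the open set `U_ψ` of points at which some
`ψ f` does not vanish, and it is then unique. -/
def IsDual (m : Morphism 𝒜 ℬ) (y : Y) (x : X) : Prop := ∀ f, m.ψ f y = f x

theorem fibreIdeal_le (m : Morphism 𝒜 ℬ) {y : Y} {x : X} (h : m.IsDual y x) :
    𝒜.fibreIdeal x ≤ (ℬ.fibreIdeal y).comap (LinearMapClass.linearMap m.Ψ) := by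
  refine Submodule.topologicalClosure_minimal _ ?_
    ((ℬ.isClosed_fibreIdeal y).preimage (AddMonoidHomClass.continuous_of_bound m.Ψ 1
      fun a => by rw [one_mul]; exact NonUnitalStarAlgHom.norm_apply_le m.Ψ a))
  refine Submodule.span_le.mpr ?_
  rintro _ ⟨f, a, hf, rfl⟩
  exact Submodule.le_topologicalClosure _
    (Submodule.subset_span ⟨m.ψ f, m.Ψ a, (h f).trans hf, (m.map_act f a).symm⟩)

/-- The map `Ψ_y : A_x → B_y`, `a(x) ↦ Ψ(a)(y)`, induced by a morphism on the fibres, where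
`x = ψ^*(y)`. It is induced by a *-homomorphism on quotients by closed ideals, so it is an
isomorphism if and only if it is bijective. -/
def fibreMap (m : Morphism 𝒜 ℬ) {y : Y} {x : X} (h : m.IsDual y x) : 𝒜.Fibre x →ₗ[ℂ] ℬ.Fibre y :=
  Submodule.mapQ _ _ (LinearMapClass.linearMap m.Ψ) (m.fibreIdeal_le h)

/-- A morphism is injective if `Ψ` and all the fibre maps `Ψ_y : A_{ψ^*(y)} → B_y`, for `y` in the
set `Y_B` of points with nonzero fibre, are injective. -/
def IsInjective (m : Morphism 𝒜 ℬ) : Prop :=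
  Function.Injective m.Ψ ∧
    ∀ y ∈ ℬ.support, ∃ (x : X) (h : m.IsDual y x), Function.Injective (m.fibreMap h)

/-- A `C₀(X)`-linear *-homomorphism `Ψ`, as a morphism `(Ψ, id)`. -/
def ofLinear {ℬ : C0Algebra X B} (Ψ : A →⋆ₙₐ[ℂ] B)
    (h : ∀ f a, Ψ ((𝒜.μ f).fst a) = (ℬ.μ f).fst (Ψ a)) : Morphism 𝒜 ℬ where
  Ψ := Ψ
  ψ := NonUnitalStarAlgHom.id ℂ _
  map_act := h

end Morphism

/-- A compactification `(B, K, μ_B)` of the `C₀(X)`-algebra `(A, X, μ_A)`. -/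
structure Compactification [T2Space X] [LocallyCompactSpace X] (𝒜 : C0Algebra X A)
    (K B : Type*) [TopologicalSpace K] [CompactSpace K] [T2Space K]
    [NonUnitalCStarAlgebra B] where
  /-- the embedding of `X_A` into its compactification `K` -/
  ι : C(𝒜.support, K)
  isDenseEmbedding : IsDenseEmbedding ι
  /-- the `C(K)`-algebra `(B, K, μ_B)` -/
  alg : C0Algebra K B
  /-- the embedding of `A` into `B` -/
  Ψ : A →⋆ₙₐ[ℂ] B
  injective : Function.Injective Ψ
  linear : ∀ f a, Ψ (((𝒜.baseChange ι).μ f).fst a) = (alg.μ f).fst (Ψ a)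
  mul_mem : ∀ b a, b * Ψ a ∈ Set.range Ψ
  mem_mul : ∀ b a, Ψ a * b ∈ Set.range Ψ
  essential : ∀ b, (∀ a, b * Ψ a = 0) → b = 0
  fibre_bijective : ∀ x : 𝒜.support, Function.Bijective
    ((Morphism.ofLinear (𝒜 := 𝒜.baseChange ι) (ℬ := alg) Ψ linear).fibreMap
      (y := ι x) (x := ι x) fun _ => rfl)

end C0Algebra

end

open scoped ZeroAtInfty MultiplierAlgebra BoundedContinuousFunction

noncomputable section

open Topology

namespace DoubleCentralizer

variable {A B : Type*} [NonUnitalCStarAlgebra A] [NonUnitalCStarAlgebra B]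
  (Ψ : A →⋆ₙₐ[ℂ] B) (hΨ : Function.Injective Ψ)
  (hl : ∀ b a, b * Ψ a ∈ Set.range Ψ) (hr : ∀ b a, Ψ a * b ∈ Set.range Ψ)

/-- An element of `B` acts by multiplication on a C*-algebra `A` embedded as an ideal of `B`. -/
def ofIdeal (b : B) : 𝓜(ℂ, A) where
  toProd :=
    (LinearMap.mkContinuous
      { toFun := fun a => (hl b a).choose
        map_add' := fun a c => hΨ ((hl b (a + c)).choose_spec.trans (by
          rw [map_add, mul_add, map_add, (hl b a).choose_spec, (hl b c).choose_spec]))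
        map_smul' := fun r a => hΨ ((hl b (r • a)).choose_spec.trans (by
          rw [map_smul, mul_smul_comm, RingHom.id_apply, map_smul, (hl b a).choose_spec])) } ‖b‖
      (fun a => by
        change ‖(hl b a).choose‖ ≤ _
        rw [← NonUnitalStarAlgHom.norm_map Ψ hΨ, (hl b a).choose_spec,
          ← NonUnitalStarAlgHom.norm_map Ψ hΨ a]
        exact norm_mul_le _ _),
    LinearMap.mkContinuous
      { toFun := fun a => (hr b a).choose
        map_add' := fun a c => hΨ ((hr b (a + c)).choose_spec.trans (by
          rw [map_add, add_mul, map_add, (hr b a).choose_spec, (hr b c).choose_spec]))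
        map_smul' := fun r a => hΨ ((hr b (r • a)).choose_spec.trans (by
          rw [map_smul, smul_mul_assoc, RingHom.id_apply, map_smul, (hr b a).choose_spec])) } ‖b‖
      (fun a => by
        change ‖(hr b a).choose‖ ≤ _
        rw [← NonUnitalStarAlgHom.norm_map Ψ hΨ, (hr b a).choose_spec,
          ← NonUnitalStarAlgHom.norm_map Ψ hΨ a, mul_comm ‖b‖]
        exact norm_mul_le _ _))
  central a c := hΨ (by
    change Ψ ((hr b a).choose * c) = Ψ (a * (hl b c).choose)
    rw [map_mul, map_mul, (hr b a).choose_spec, (hl b c).choose_spec, mul_assoc])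

theorem map_ofIdeal_fst (b : B) (a : A) : Ψ ((ofIdeal Ψ hΨ hl hr b).fst a) = b * Ψ a :=
  (hl b a).choose_spec

theorem map_ofIdeal_snd (b : B) (a : A) : Ψ ((ofIdeal Ψ hΨ hl hr b).snd a) = Ψ a * b :=
  (hr b a).choose_spec

/-- The canonical *-homomorphism `B → M(A)` for a C*-algebra `A` embedded as an ideal of `B`. -/
def ofIdealHom : B →⋆ₙₐ[ℂ] 𝓜(ℂ, A) where
  toFun := ofIdeal Ψ hΨ hl hr
  map_smul' r b := ext_fst fun a => hΨ (by
    rw [map_ofIdeal_fst]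
    change _ = Ψ (r • (ofIdeal Ψ hΨ hl hr b).fst a)
    rw [map_smul, map_ofIdeal_fst, smul_mul_assoc])
  map_zero' := ext_fst fun a => hΨ (by
    rw [map_ofIdeal_fst, zero_mul]
    exact (map_zero Ψ).symm)
  map_add' b c := ext_fst fun a => hΨ (by
    rw [map_ofIdeal_fst]
    change _ = Ψ ((ofIdeal Ψ hΨ hl hr b).fst a + (ofIdeal Ψ hΨ hl hr c).fst a)
    rw [map_add, map_ofIdeal_fst, map_ofIdeal_fst, add_mul])
  map_mul' b c := ext_fst fun a => hΨ (by
    rw [map_ofIdeal_fst]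
    change _ = Ψ ((ofIdeal Ψ hΨ hl hr b).fst ((ofIdeal Ψ hΨ hl hr c).fst a))
    rw [map_ofIdeal_fst, map_ofIdeal_fst, mul_assoc])
  map_star' b := ext_fst fun a => hΨ (by
    rw [map_ofIdeal_fst, star_fst, map_star, map_ofIdeal_snd, map_star, star_mul, star_star])

theorem map_ofIdealHom_fst (b : B) (a : A) : Ψ ((ofIdealHom Ψ hΨ hl hr b).fst a) = b * Ψ a :=
  map_ofIdeal_fst Ψ hΨ hl hr b a

theorem ofIdealHom_map (a : A) : ofIdealHom Ψ hΨ hl hr (Ψ a) = (a : 𝓜(ℂ, A)) :=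
  ext_fst fun c => hΨ (by rw [map_ofIdealHom_fst, coe_fst, ← map_mul]; rfl)

theorem ofIdealHom_injective (hess : ∀ b, (∀ a, b * Ψ a = 0) → b = 0) :
    Function.Injective (ofIdealHom Ψ hΨ hl hr) := by
  refine (injective_iff_map_eq_zero _).mpr fun b hb => hess b fun a => ?_
  rw [← map_ofIdealHom_fst Ψ hΨ hl hr, hb]
  exact map_zero Ψ

end DoubleCentralizer

namespace C0Algebra

open DoubleCentralizer

variable {X A : Type*} [TopologicalSpace X] [NonUnitalCStarAlgebra A]

theorem eval_act (𝒜 : C0Algebra X A) (f : C₀(X, ℂ)) (x : X) (a : A) :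
    𝒜.eval x ((𝒜.μ f).fst a) = f x • 𝒜.eval x a := by
  have : 𝒜.eval x ((𝒜.μ f).fst a - f x • a) = 0 :=
    𝒜.eval_eq_zero_iff.mpr (𝒜.act_sub_mem f x a)
  rw [← sub_eq_zero, ← this]
  simp only [eval, map_sub, map_smul]

section Local

variable [T2Space X] [LocallyCompactSpace X] (𝒜 : C0Algebra X A)

/-- A function in `C₀(X)` bounded by `1` with value `1` at `x` and vanishing outside `U`. -/
theorem exists_bump {U : Set X} (hU : IsOpen U) {x : X} (hx : x ∈ U) :
    ∃ g : C₀(X, ℂ), g x = 1 ∧ (∀ y, ‖g y‖ ≤ 1) ∧ ∀ y ∉ U, g y = 0 := by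
  obtain ⟨k, hk1, hk0, hkc, hk01⟩ := exists_continuous_one_zero_of_isCompact
    (isCompact_singleton (x := x)) hU.isClosed_compl (by simpa using hx)
  have hv : ∀ y, ofReal k hkc y = (k y : ℂ) := fun y => rfl
  refine ⟨ofReal k hkc, ?_, norm_ofReal_le hkc hk01, fun y hy => ?_⟩
  · rw [hv, hk1 (Set.mem_singleton x)]; simp
  · rw [hv, hk0 hy]; simp

/-- The fibre maps of an injective `C₀(X)`-linear *-homomorphism are injective. -/
theorem mem_fibreIdeal_of_map_mem {B : Type*} [NonUnitalCStarAlgebra B] {ℬ : C0Algebra X B}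
    {Ψ : A →⋆ₙₐ[ℂ] B} (hΨ : Function.Injective Ψ)
    (h : ∀ f a, Ψ ((𝒜.μ f).fst a) = (ℬ.μ f).fst (Ψ a)) {x : X} {a : A}
    (ha : Ψ a ∈ ℬ.fibreIdeal x) : a ∈ 𝒜.fibreIdeal x := by
  refine 𝒜.mem_of_norm_eval_le_zero (le_of_forall_pos_le_add fun ε hε => ?_)
  obtain ⟨U, hU, hxU, hg⟩ := ℬ.exists_isOpen_act ha hε
  obtain ⟨g, hgx, hg1, hg0⟩ := exists_bump hU hxU
  have h1 := hg g hg1 hg0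
  rw [← h, NonUnitalStarAlgHom.norm_map Ψ hΨ] at h1
  have h2 := 𝒜.norm_eval_le_norm x ((𝒜.μ g).fst a)
  rw [eval_act, hgx, one_smul] at h2
  linarith

theorem sectionHom_mul_mem_idealH (x : 𝒜.support) {f : 𝒜.support →ᵇ ℂ} (hf : f x = 0)
    (m : 𝓜(ℂ, A)) : 𝒜.sectionHom f * m ∈ 𝒜.idealH (stoneCechUnit (x : X)) := by
  rw [← SetLike.mem_coe, ← (𝒜.isClosed_idealH _).closure_eq, Metric.mem_closure_iff]
  intro ε hε
  have hpos : 0 < ‖m‖ + 1 := by positivity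
  set δ := ε / (‖m‖ + 1) with hδ
  have hδ0 : 0 < δ := by positivity
  have hO : IsOpen {y : 𝒜.support | ‖f y‖ < δ} := isOpen_lt (by fun_prop) continuous_const
  obtain ⟨W, hW, hWO⟩ := IsEmbedding.subtypeVal.isOpen_iff.mp hO
  have hxW : (x : X) ∈ W := by
    have : x ∈ Subtype.val ⁻¹' W := by rw [hWO]; simpa [hf] using hδ0
    exact this
  obtain ⟨k, hkx, hk1, hk0⟩ := exists_bump hW hxW
  -- `k` extended to `βX` through its values in the closed unit disc
  let kc : X → Metric.closedBall (0 : ℂ) 1 := fun y => ⟨k y, by simpa using hk1 y⟩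
  have hkc : Continuous kc := (map_continuous k).subtype_mk _
  let G : C(StoneCech X, ℂ) :=
    ⟨fun y => 1 - (stoneCechExtend hkc y).1, continuous_const.sub
      (continuous_subtype_val.comp (continuous_stoneCechExtend hkc))⟩
  let g : C₀(StoneCech X, ℂ) := ZeroAtInftyContinuousMap.ContinuousMap.liftZeroAtInfty G
  have hgv : ∀ y : X, g (stoneCechUnit y) = 1 - k y := fun y => by
    change 1 - (stoneCechExtend hkc (stoneCechUnit y)).1 = _
    rw [stoneCechExtend_stoneCechUnit]
  refine ⟨𝒜.μM g * (𝒜.sectionHom f * m), Submodule.le_topologicalClosure _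
    (Submodule.subset_span ⟨g, _, ?_, rfl⟩), ?_⟩
  · rw [hgv, hkx, sub_self]
  · have h1 : 𝒜.sectionHom f * m - 𝒜.μM g * (𝒜.sectionHom f * m) =
        𝒜.sectionHom (f - pullback 𝒜.toBetaX g * f) * m := by
      rw [map_sub, map_mul, sub_mul, mul_assoc]; rfl
    rw [dist_eq_norm, h1]
    refine (norm_mul_le _ _).trans_lt ?_
    have h2 : ‖f - pullback 𝒜.toBetaX g * f‖ ≤ δ := by
      refine (BoundedContinuousFunction.norm_le hδ0.le).mpr fun y => ?_
      have h3 : (f - pullback 𝒜.toBetaX g * f) y = k y * f y := by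
        change f y - g (stoneCechUnit (y : X)) * f y = _
        rw [hgv]; ring
      rw [h3, norm_mul]
      by_cases hy : (y : X) ∈ W
      · have h4 : ‖f y‖ < δ := by
          have : y ∈ Subtype.val ⁻¹' W := hy
          rw [hWO] at this
          exact this
        nlinarith [hk1 y, norm_nonneg (f y), norm_nonneg (k y)]
      · rw [hk0 _ hy]; simpa using hδ0.le
    have h5 := (NonUnitalStarAlgHom.norm_apply_le 𝒜.sectionHom
      (f - pullback 𝒜.toBetaX g * f)).trans h2
    have h6 : δ * (‖m‖ + 1) = ε := by rw [hδ]; field_simp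
    nlinarith [norm_nonneg m]

theorem fst_mem_fibreIdeal_of_mem_idealH (x : 𝒜.support) {m : 𝓜(ℂ, A)}
    (hm : m ∈ 𝒜.idealH (stoneCechUnit (x : X))) (a : A) : m.fst a ∈ 𝒜.fibreIdeal x := by
  let T : 𝓜(ℂ, A) →ₗ[ℂ] A :=
    { toFun := fun m => m.fst a, map_add' := fun _ _ => rfl, map_smul' := fun _ _ => rfl }
  have hT : Continuous T := AddMonoidHomClass.continuous_of_bound T ‖a‖ fun m => by
    rw [mul_comm, ← norm_fst m]
    exact m.fst.le_opNorm a
  have : 𝒜.idealH (stoneCechUnit (x : X)) ≤ (𝒜.fibreIdeal x).comap T := by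
    refine Submodule.topologicalClosure_minimal _ ?_ ((𝒜.isClosed_fibreIdeal _).preimage hT)
    refine Submodule.span_le.mpr ?_
    rintro _ ⟨f, n, hf, rfl⟩
    have h := 𝒜.eval_baseChange 𝒜.toBetaX f (n.fst a) x
    have hf' : f (𝒜.toBetaX x) = 0 := hf
    rw [hf', zero_smul, eval_eq_zero_iff] at h
    exact h
  exact this hm

theorem coe_betaAlgebra_act (f : C₀(StoneCech 𝒜.support, ℂ)) (b : 𝒜.beta) :
    (((𝒜.betaAlgebra.μ f).fst b : 𝒜.beta) : 𝓜(ℂ, A)) =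
      𝒜.sectionHom (pullback 𝒜.toBeta f) * b := rfl

end Local

namespace Compactification

variable [T2Space X] [LocallyCompactSpace X] {𝒜 : C0Algebra X A}
  {K B : Type*} [TopologicalSpace K] [CompactSpace K] [T2Space K] [NonUnitalCStarAlgebra B]
  (C : 𝒜.Compactification K B)

/-- The canonical *-homomorphism `B → M(A)`. -/
def toMultiplier : B →⋆ₙₐ[ℂ] 𝓜(ℂ, A) := ofIdealHom C.Ψ C.injective C.mul_mem C.mem_mul

theorem map_toMultiplier_fst (b : B) (a : A) : C.Ψ ((C.toMultiplier b).fst a) = b * C.Ψ a :=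
  map_ofIdealHom_fst _ _ _ _ _ _

theorem toMultiplier_map (a : A) : C.toMultiplier (C.Ψ a) = (a : 𝓜(ℂ, A)) :=
  ofIdealHom_map _ _ _ _ a

theorem toMultiplier_act (f : C₀(K, ℂ)) (b : B) :
    C.toMultiplier ((C.alg.μ f).fst b) =
      𝒜.sectionHom (pullback C.ι f) * C.toMultiplier b := by
  refine ext_fst fun a => C.injective ?_
  rw [map_toMultiplier_fst]
  have h := C.linear f ((C.toMultiplier b).fst a)
  rw [map_toMultiplier_fst] at h
  refine Eq.trans ?_ h.symm
  apply coe_inj'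
  rw [← mul_coe_eq, ← coeHom_apply, map_mul, coeHom_apply, coeHom_apply, ← mul_coe_eq,
    ← coeHom_apply (𝕜 := ℂ) (b * _), map_mul, mul_assoc]
  rfl

theorem exists_sub_mem (b : B) (x : 𝒜.support) : ∃ a, b - C.Ψ a ∈ C.alg.fibreIdeal (C.ι x) := by
  obtain ⟨q, hq⟩ := (C.fibre_bijective x).2 (C.alg.eval (C.ι x) b)
  obtain ⟨a, rfl⟩ := Submodule.Quotient.mk_surjective _ q
  exact ⟨a, (Submodule.Quotient.eq _).mp hq.symm⟩

theorem toMultiplier_mem_idealH (x : 𝒜.support) {b : B} (hb : b ∈ C.alg.fibreIdeal (C.ι x)) :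
    C.toMultiplier b ∈ 𝒜.idealH (stoneCechUnit (x : X)) := by
  have : C.alg.fibreIdeal (C.ι x) ≤ (𝒜.idealH (stoneCechUnit (x : X))).comap
      (LinearMapClass.linearMap C.toMultiplier) := by
    refine Submodule.topologicalClosure_minimal _ ?_
      ((𝒜.isClosed_idealH _).preimage (AddMonoidHomClass.continuous_of_bound C.toMultiplier 1
        fun b => by rw [one_mul]; exact NonUnitalStarAlgHom.norm_apply_le _ b))
    refine Submodule.span_le.mpr ?_
    rintro _ ⟨f, b, hf, rfl⟩
    change C.toMultiplier ((C.alg.μ f).fst b) ∈ 𝒜.idealH (stoneCechUnit (x : X))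
    rw [toMultiplier_act]
    exact 𝒜.sectionHom_mul_mem_idealH x hf _
  exact this hb

theorem toMultiplier_mem_beta (b : B) : C.toMultiplier b ∈ 𝒜.beta := by
  intro x hx
  obtain ⟨a, ha⟩ := C.exists_sub_mem b ⟨x, hx⟩
  refine 𝒜.mem_addIdealH.mpr
    ⟨a, C.toMultiplier (b - C.Ψ a), C.toMultiplier_mem_idealH ⟨x, hx⟩ ha, ?_⟩
  rw [map_sub, toMultiplier_map, add_sub_cancel]

/-- The canonical *-homomorphism `B → A^β`. -/
def toBeta : B →⋆ₙₐ[ℂ] 𝒜.beta :=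
  NonUnitalStarAlgHom.codRestrict C.toMultiplier 𝒜.beta C.toMultiplier_mem_beta

theorem coe_toBeta (b : B) : ((C.toBeta b : 𝒜.beta) : 𝓜(ℂ, A)) = C.toMultiplier b := rfl

theorem toBeta_injective : Function.Injective C.toBeta := fun _ _ h =>
  ofIdealHom_injective _ C.injective C.mul_mem C.mem_mul C.essential (congrArg Subtype.val h)

theorem betaExtend_toBeta (x : 𝒜.support) : 𝒜.betaExtend C.ι (𝒜.toBeta x) = C.ι x :=
  stoneCechExtend_stoneCechUnit C.ι.continuous x

theorem toBeta_act (f : C₀(K, ℂ)) (b : B) :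
    C.toBeta ((C.alg.μ f).fst b) =
      (𝒜.betaAlgebra.μ (pullbackC₀ (𝒜.betaExtend C.ι) f)).fst (C.toBeta b) := by
  refine Subtype.ext ?_
  rw [coe_toBeta, toMultiplier_act, coe_betaAlgebra_act, coe_toBeta]
  congr 2
  ext x
  exact congrArg f (C.betaExtend_toBeta x).symm

/-- If `‖(b a)(x)‖ ≤ ε` for all `a` in the unit ball of `A`, then `‖b(x)‖ ≤ ε`. -/
theorem norm_eval_le_of_forall_fst (x : 𝒜.support) (b : B) {ε : ℝ}
    (h : ∀ a : A, ‖a‖ ≤ 1 → ‖𝒜.eval x ((C.toMultiplier b).fst a)‖ ≤ ε) :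
    ‖C.alg.eval (C.ι x) b‖ ≤ ε := by
  obtain ⟨a, ha⟩ := C.exists_sub_mem b x
  have hmul : ∀ c : A, 𝒜.eval x ((C.toMultiplier b).fst c) = 𝒜.eval x (a * c) := by
    intro c
    have h1 := 𝒜.fst_mem_fibreIdeal_of_mem_idealH x (C.toMultiplier_mem_idealH x ha) c
    rw [map_sub, toMultiplier_map] at h1
    exact (Submodule.Quotient.eq _).mpr h1
  have hmem : ∀ {j : A}, j ∈ 𝒜.fibreIdeal x → C.Ψ j ∈ C.alg.fibreIdeal (C.ι x) := fun hj => by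
    rw [← 𝒜.fibreIdeal_baseChange C.isDenseEmbedding.isEmbedding x] at hj
    exact (Morphism.ofLinear (𝒜 := 𝒜.baseChange C.ι) (ℬ := C.alg) C.Ψ C.linear).fibreIdeal_le
      (y := C.ι x) (x := C.ι x) (fun _ => rfl) hj
  have hle : ‖𝒜.eval x a‖ ≤ ε := by
    refine le_of_forall_pos_le_add fun η hη => ?_
    let _ := CStarAlgebra.spectralOrder A
    have _ := CStarAlgebra.spectralOrderedRing A
    have hu := CStarAlgebra.increasingApproximateUnit A
    have _ := hu.neBot
    have e1 := Metric.tendsto_nhds.mp (hu.tendsto_mul_left a) η hη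
    obtain ⟨u, hu1, hu2⟩ := (e1.and hu.eventually_norm).exists
    rw [dist_comm, dist_eq_norm] at hu1
    have e2 := h u hu2
    rw [hmul] at e2
    have e3 : 𝒜.eval x a = 𝒜.eval x (a * u) + 𝒜.eval x (a - a * u) := by
      simp only [eval, map_sub]; abel
    rw [e3]
    exact (norm_add_le _ _).trans
      (add_le_add e2 ((𝒜.norm_eval_le_norm _ _).trans hu1.le))
  refine le_of_forall_gt_imp_ge_of_dense fun d hd => ?_
  obtain ⟨j, hj, hjd⟩ := 𝒜.exists_mem_of_norm_eval_lt (hle.trans_lt hd)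
  refine (C.alg.norm_eval_le_of_sub_mem (b := C.Ψ (a - j)) ?_).trans
    ((NonUnitalStarAlgHom.norm_apply_le C.Ψ _).trans hjd.le)
  have := add_mem ha (hmem hj)
  rw [map_sub]
  convert! this using 1
  abel

theorem mem_fibreIdeal_of_toBeta_mem (hc : C.alg.IsContinuous) {y : StoneCech 𝒜.support} {b : B}
    (hb : C.toBeta b ∈ 𝒜.betaAlgebra.fibreIdeal y) :
    b ∈ C.alg.fibreIdeal (𝒜.betaExtend C.ι y) := by
  refine C.alg.mem_of_norm_eval_le_zero (le_of_forall_pos_le_add fun ε hε => ?_)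
  rw [zero_add]
  obtain ⟨U, hU, hyU, hg⟩ := 𝒜.betaAlgebra.exists_isOpen_act hb hε
  have hF : IsClosed {z | ‖C.alg.eval (𝒜.betaExtend C.ι z) b‖ ≤ ε} :=
    isClosed_le ((hc b).comp (𝒜.betaExtend C.ι).continuous) continuous_const
  refine closure_minimal ?_ hF (denseRange_stoneCechUnit.open_subset_closure_inter hU hyU)
  rintro _ ⟨hxU, x, rfl⟩
  change ‖C.alg.eval (𝒜.betaExtend C.ι (𝒜.toBeta x)) b‖ ≤ ε
  rw [betaExtend_toBeta]
  obtain ⟨g, hgx, hg1, hg0⟩ := exists_bump hU hxU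
  have h1 : ‖𝒜.sectionHom (pullback 𝒜.toBeta g) * C.toMultiplier b‖ ≤ ε := hg g hg1 hg0
  refine C.norm_eval_le_of_forall_fst x b fun a ha => ?_
  have h2 := 𝒜.eval_sectionHom (pullback 𝒜.toBeta g) ((C.toMultiplier b).fst a) x
  have h3 : pullback 𝒜.toBeta g x = 1 := hgx
  rw [h3, one_smul] at h2
  rw [← h2]
  refine (𝒜.norm_eval_le_norm _ _).trans ?_
  have h4 := (𝒜.sectionHom (pullback 𝒜.toBeta g) * C.toMultiplier b).fst.le_opNorm a
  rw [norm_fst] at h4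
  exact h4.trans ((mul_le_of_le_one_right (norm_nonneg _) ha).trans h1)

end Compactification

theorem Morphism.fibreMap_injective {Y B : Type*} [TopologicalSpace Y] [NonUnitalCStarAlgebra B]
    {𝒜 : C0Algebra X A} {ℬ : C0Algebra Y B} (m : Morphism 𝒜 ℬ) {y : Y} {x : X}
    (h : m.IsDual y x) (hm : ∀ a, m.Ψ a ∈ ℬ.fibreIdeal y → a ∈ 𝒜.fibreIdeal x) :
    Function.Injective (m.fibreMap h) := by
  refine (injective_iff_map_eq_zero _).mpr fun q hq => ?_
  obtain ⟨a, rfl⟩ := Submodule.Quotient.mk_surjective _ q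
  exact (Submodule.Quotient.mk_eq_zero _).mpr (hm a ((Submodule.Quotient.mk_eq_zero _).mp hq))

end C0Algebra

end

theorem theoremt {X A K B : Type*} [TopologicalSpace X] [T2Space X] [LocallyCompactSpace X]
    [NonUnitalCStarAlgebra A] [TopologicalSpace K] [CompactSpace K] [T2Space K]
    [NonUnitalCStarAlgebra B] (𝒜 : C0Algebra X A) (C : 𝒜.Compactification K B) :
    ∃ Φ : B →⋆ₙₐ[ℂ] 𝒜.beta, Function.Injective Φ ∧
      (∀ a : A, ((Φ (C.Ψ a) : 𝒜.beta) : 𝓜(ℂ, A)) = (a : 𝓜(ℂ, A))) ∧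
      (∀ (f : C₀(K, ℂ)) (b : B),
        Φ ((C.alg.μ f).fst b) = ((𝒜.betaAlgebraOver C.ι).μ f).fst (Φ b)) ∧
      (∃ m : C0Algebra.Morphism C.alg (𝒜.betaAlgebraOver C.ι),
        m.Ψ = Φ ∧ m.ψ = NonUnitalStarAlgHom.id ℂ C₀(K, ℂ) ∧ m.IsInjective) ∧
      (∃ m : C0Algebra.Morphism C.alg 𝒜.betaAlgebra,
        m.Ψ = Φ ∧ m.ψ = C0Algebra.pullbackC₀ (𝒜.betaExtend C.ι) ∧
        (𝒜.support = Set.univ → C.alg.IsContinuous → m.IsInjective)) := by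
  have hK : ∀ (f : C₀(K, ℂ)) (b : B),
      C.toBeta ((C.alg.μ f).fst b) = ((𝒜.betaAlgebraOver C.ι).μ f).fst (C.toBeta b) :=
    C.toBeta_act
  refine ⟨C.toBeta, C.toBeta_injective,
    fun a => C.toMultiplier_map a, hK,
    ⟨C0Algebra.Morphism.ofLinear C.toBeta hK, rfl, rfl, C.toBeta_injective, fun k _ =>
      ⟨k, fun _ => rfl, C0Algebra.Morphism.fibreMap_injective _ _ fun b hb =>
        C.alg.mem_fibreIdeal_of_map_mem C.toBeta_injective hK hb⟩⟩,
    ⟨⟨C.toBeta, C0Algebra.pullbackC₀ (𝒜.betaExtend C.ι), C.toBeta_act⟩, rfl, rfl,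
      fun _ hc => ⟨C.toBeta_injective, fun y _ =>
        ⟨𝒜.betaExtend C.ι y, fun _ => rfl, C0Algebra.Morphism.fibreMap_injective _ _ fun b hb =>
          C.mem_fibreIdeal_of_toBeta_mem hc hb⟩⟩⟩⟩
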